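/- Let $N\ge 1$ and let $G=\begin{bmatrix}G_{11}&G_{12}\\G_{21}&G_{22}\end{bmatrix}$ be the discrete-time plant with $G_{11}=C_1(zI-A)^{-1}B_1$, $G_{12}=C_1(zI-A)^{-1}B_2+D_{12}$, $G_{21}=C_2(zI-A)^{-1}B_1+D_{21}$, $G_{22}=C_2(zI-A)^{-1}B_2$, where all matrices are real, $A$ is $n\times n$, $B_j$ has $p_j$ columns and $C_j$ has $q_j$ rows. Assume that $(A,B_j)$ is stabilizable and $(A,C_j)$ is detectable for $j=1,2$, that $D_{12}^{T}[C_1\ D_{12}]=[0\ I]$ and $D_{21}[B_1^{T}\ D_{21}^{T}]=[0\ I]$. Let $\mathcal R_{\mathrm p}$ be the space of proper real rational transfer matrices. Let $\mathcal Y_i\subset\mathbb R^{p_2\times q_2}$ ($1\le i\le N$) be linear subspaces (for example, given by sparsity patterns), let $\mathcal Y=\bigoplus_{i=1}^N z^{-i}\mathcal Y_i$ and $\mathcal S=\mathcal Y\oplus z^{-(N+1)}\mathcal R_{\mathrm p}$, and assume that $\mathcal S$ is quadratically invariant with respect to $G_{22}$, i.e. $\mathcal K G_{22}\mathcal K\in\mathcal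 S$ for all $\mathcal K\in\mathcal S$. The decentralized $\mathcal H_2$ problem is $$\min_{\mathcal K\in\mathcal S}\ \|G_{11}+G_{12}\mathcal K(I-G_{22}\mathcal K)^{-1}G_{21}\|_{\mathcal H_2}^2,$$ where $\|\sum_i z^{-i}H_i\|_{\mathcal H_2}^2=\sum_i\operatorname{Tr}(H_iH_i^{T})\in[0,\infty]$. Let $X$ and $Y$ be the (symmetric) stabilizing solutions of $$X=C_1^TC_1+A^TXA-A^TXB_2\Omega^{-1}B_2^TXA,\qquad Y=B_1B_1^T+AYA^T-AYC_2^T\Psi^{-1}C_2YA^T,$$ with $\Omega=I+B_2^TXB_2$, $\Psi=I+C_2YC_2^T$; let $K=-\Omega^{-1}B_2^TXA$ and $L=-AYC_2^T\Psi^{-1}$, so that $A_K=A+B_2K$ and $A_L=A+LC_2$ are stable. Put $\hat M=K(zI-A_K)^{-1}B_2+I$, $\hat N=C_2(zI-A_K)^{-1}B_2$, $\hat Y=-K(zI-A_K)^{-1}L$, $\hat X=I-C_2(zI-A_K)^{-1}L$, $\tilde M=I+C_2(zI-A_L)^{-1}L$ and $P_{11}=G_{11}+G_{12}\hat Y\tilde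 MG_{21}$. Consider the quadratic program $$\min_V\ \|\Omega^{1/2}V\Psi^{1/2}\|_{\mathcal H_2}^2\quad\text{over } V=\sum_{i=1}^N z^{-i}V_i,\ V_i\in\mathbb R^{p_2\times q_2},\quad\text{s.t. } \mathbb P\big((\hat Y-\hat MV)\tilde M\big)\in\mathcal Y,$$ where $\mathbb P$ keeps the coefficients of $z^{-1},\dots,z^{-N}$ and deletes the others. Let $\operatorname{vec}$ stack columns, let $R=\Psi\otimes\Omega$ and $$A_v=\begin{bmatrix}I_{q_2}\otimes A_K&0\\ C_2^T\otimes K&A_L^T\otimes I_{p_2}\end{bmatrix},\quad B_v=\begin{bmatrix}I_{q_2}\otimes B_2\\ C_2^T\otimes I_{p_2}\end{bmatrix},\quad C_v=\begin{bmatrix}I_{q_2}\otimes K&L^T\otimes I_{p_2}\end{bmatrix}.$$ For $1\le i\le N$ let the columns of $E_i$ and $F_i$ form orthonormal bases of $\operatorname{vec}(\mathcal Y_i)$ and $\operatorname{vec}(\mathcal Y_i^{\perp})$, and put $A_i=A_v-B_vF_iF_i^TC_v$, $B_i=B_vE_i$, $C_i=-R^{1/2}F_iF_i^TC_v$, $D_i=R^{1/2}E_i$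 (these $B_i,C_i$ are distinct from the plant matrices). Let $X_{N+1}=0$ and, for $i=N,\dots,1$, $$X_i=C_i^TC_i+A_i^TX_{i+1}A_i-(A_i^TX_{i+1}B_i+C_i^TD_i)(D_i^TD_i+B_i^TX_{i+1}B_i)^{-1}(B_i^TX_{i+1}A_i+D_i^TC_i),$$ $$K_i=-(D_i^TD_i+B_i^TX_{i+1}B_i)^{-1}(B_i^TX_{i+1}A_i+D_i^TC_i).$$ Finally let $x_1=\begin{bmatrix}\operatorname{vec}(L)\\0_{np_2\times1}\end{bmatrix}$ and $x_{i+1}=(A_i+B_iK_i)x_i$. Then the $V=\sum_{i=1}^Nz^{-i}V_i$ given by $$\operatorname{vec}(V_i)=(E_iK_i-F_iF_i^TC_v)x_i,\qquad 1\le i\le N,$$ is the unique optimal solution of the quadratic program, whose optimal value is $x_1^TX_1x_1\ge 0$. The controller $\mathcal K^*=(\hat Y-\hat MV)(\hat X-\hat NV)^{-1}$ lies in $\mathcal S$, internally stabilizes $G_{22}$ and attains the minimum in the decentralized $\mathcal H_2$ problem, and the optimal value of that problem is the finite number $\|P_{11}\|_{\mathcal H_2}^2+x_1^TX_1x_1$.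 -/

import Mathlib

open scoped Kronecker

noncomputable section

namespace DelayHTwo

/-! ### Proper transfer matrices

A proper rational function of `z` is identified with its expansion at `z = ∞`, a power series in the
delay variable `w = 1/z`.  In the whole file `PowerSeries.X` therefore stands for `1/z`. -/

/-- `m × n` matrices of (formal) expansions `∑ i, z⁻ⁱ Gᵢ`. -/
abbrev TF (m n : ℕ) := Matrix (Fin m) (Fin n) (PowerSeries ℝ)

/-- The coefficient matrix `Gᵢ` of `z⁻ⁱ` in `G`. -/
def coeffMat {m n : ℕ} (i : ℕ) (G : TF m n) : Matrix (Fin m) (Fin n) ℝ :=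
  G.map (PowerSeries.coeff i)

/-- The series `∑ i, z⁻ⁱ cᵢ`. -/
def ofCoeffs {m n : ℕ} (c : ℕ → Matrix (Fin m) (Fin n) ℝ) : TF m n :=
  Matrix.of fun a b => PowerSeries.mk fun i => c i a b

/-- A real matrix seen as a constant transfer matrix. -/
def const {m n : ℕ} (D : Matrix (Fin m) (Fin n) ℝ) : TF m n :=
  D.map (PowerSeries.C (R := ℝ))

/-- Proper real rational transfer matrices: each entry is a quotient `p(1/z) / q(1/z)` of polynomials
in `1/z` such that `q` does not vanish at `z = ∞`. -/
def IsProperRational {m n : ℕ} (G : TF m n) : Prop :=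
  ∀ a b, ∃ p q : Polynomial ℝ, q.coeff 0 ≠ 0 ∧
    (q : PowerSeries ℝ) * G a b = (p : PowerSeries ℝ)

/-- Stable proper real rational transfer matrices (no pole with `|z| ≥ 1` or at `z = ∞`): each entry
is a quotient `p(1/z) / q(1/z)` such that `q(w) ≠ 0` whenever `|w| ≤ 1`. -/
def IsStableTF {m n : ℕ} (G : TF m n) : Prop :=
  ∀ a b, ∃ p q : Polynomial ℝ, (∀ w : ℂ, ‖w‖ ≤ 1 → Polynomial.aeval w q ≠ 0) ∧
    (q : PowerSeries ℝ) * G a b = (p : PowerSeries ℝ)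

/-- The squared `H₂` norm `∑ i, Tr(Gᵢ Gᵢᵀ)`, with value `∞` if `G` is not in `H₂`. -/
def h2NormSq {m n : ℕ} (G : TF m n) : ENNReal :=
  ∑' i : ℕ, ENNReal.ofReal (coeffMat i G * (coeffMat i G).transpose).trace

/-- The transfer matrix `C (zI - A)⁻¹ B + D`; note that `(zI - A)⁻¹ = z⁻¹ (I - z⁻¹ A)⁻¹`. -/
def realization {k m n : ℕ} (A : Matrix (Fin k) (Fin k) ℝ) (B : Matrix (Fin k) (Fin n) ℝ)
    (C : Matrix (Fin m) (Fin k) ℝ) (D : Matrix (Fin m) (Fin n) ℝ) : TF m n :=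
  const C * ((PowerSeries.X : PowerSeries ℝ) •
    (1 - (PowerSeries.X : PowerSeries ℝ) • const A)⁻¹) * const B + const D

/-! ### Stability, stabilizability, detectability -/

/-- All complex eigenvalues of `A` lie in the open unit disc. -/
def IsStableMatrix {k : ℕ} (A : Matrix (Fin k) (Fin k) ℝ) : Prop :=
  ∀ μ ∈ spectrum ℂ (A.map (algebraMap ℝ ℂ)), ‖μ‖ < 1

def IsStabilizable {k m : ℕ} (A : Matrix (Fin k) (Fin k) ℝ) (B : Matrix (Fin k) (Fin m) ℝ) : Prop :=
  ∃ F : Matrix (Fin m) (Fin k) ℝ, IsStableMatrix (A + B * F)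

def IsDetectable {k m : ℕ} (A : Matrix (Fin k) (Fin k) ℝ) (C : Matrix (Fin m) (Fin k) ℝ) : Prop :=
  ∃ H : Matrix (Fin k) (Fin m) ℝ, IsStableMatrix (A + H * C)

/-! ### The plant -/

/-- State-space data of the plant: state dimension `n`, inputs of dimension `p₁`, `p₂` and outputs of
dimension `q₁`, `q₂`. -/
structure Plant (n p₁ p₂ q₁ q₂ : ℕ) where
  A : Matrix (Fin n) (Fin n) ℝ
  B₁ : Matrix (Fin n) (Fin p₁) ℝ
  B₂ : Matrix (Fin n) (Fin p₂) ℝ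
  C₁ : Matrix (Fin q₁) (Fin n) ℝ
  C₂ : Matrix (Fin q₂) (Fin n) ℝ
  D₁₂ : Matrix (Fin q₁) (Fin p₂) ℝ
  D₂₁ : Matrix (Fin q₂) (Fin p₁) ℝ

namespace Plant

variable {n p₁ p₂ q₁ q₂ : ℕ} (G : Plant n p₁ p₂ q₁ q₂)

def G₁₁ : TF q₁ p₁ := realization G.A G.B₁ G.C₁ 0
def G₁₂ : TF q₁ p₂ := realization G.A G.B₂ G.C₁ G.D₁₂
def G₂₁ : TF q₂ p₁ := realization G.A G.B₁ G.C₂ G.D₂₁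
def G₂₂ : TF q₂ p₂ := realization G.A G.B₂ G.C₂ 0

/-- The standing assumptions on the plant. -/
structure Standing : Prop where
  stabilizable₁ : IsStabilizable G.A G.B₁
  detectable₁ : IsDetectable G.A G.C₁
  stabilizable₂ : IsStabilizable G.A G.B₂
  detectable₂ : IsDetectable G.A G.C₂
  D₁₂_C₁ : G.D₁₂.transpose * G.C₁ = 0
  D₁₂_D₁₂ : G.D₁₂.transpose * G.D₁₂ = 1
  D₂₁_B₁ : G.D₂₁ * G.B₁.transpose = 0
  D₂₁_D₂₁ : G.D₂₁ * G.D₂₁.transpose = 1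

/-- The closed loop `G₁₁ + G₁₂ K (I - G₂₂ K)⁻¹ G₂₁`. -/
def closedLoop (K : TF p₂ q₂) : TF q₁ p₁ :=
  G.G₁₁ + G.G₁₂ * K * (1 - G.G₂₂ * K)⁻¹ * G.G₂₁

/-- Internal stability of the feedback loop of `G₂₂` and `K`: the four transfer matrices from
disturbances at the input and the output of `K` to the loop signals are stable. -/
def InternallyStabilizes (K : TF p₂ q₂) : Prop :=
  IsStableTF (1 - G.G₂₂ * K)⁻¹ ∧ IsStableTF (K * (1 - G.G₂₂ * K)⁻¹) ∧
    IsStableTF ((1 - G.G₂₂ * K)⁻¹ * G.G₂₂) ∧ IsStableTF (1 - K * G.G₂₂)⁻¹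

/-! ### Riccati equations and gains -/

/-- `Ω = I + B₂ᵀ X B₂`. -/
def Ω (X : Matrix (Fin n) (Fin n) ℝ) : Matrix (Fin p₂) (Fin p₂) ℝ :=
  1 + G.B₂.transpose * X * G.B₂

/-- `Ψ = I + C₂ Y C₂ᵀ`. -/
def Ψ (Y : Matrix (Fin n) (Fin n) ℝ) : Matrix (Fin q₂) (Fin q₂) ℝ :=
  1 + G.C₂ * Y * G.C₂.transpose

/-- The regulator gain `K = -Ω⁻¹ B₂ᵀ X A`. -/
def gainK (X : Matrix (Fin n) (Fin n) ℝ) : Matrix (Fin p₂) (Fin n) ℝ :=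
  -((G.Ω X)⁻¹ * G.B₂.transpose * X * G.A)

/-- The filter gain `L = -A Y C₂ᵀ Ψ⁻¹`. -/
def gainL (Y : Matrix (Fin n) (Fin n) ℝ) : Matrix (Fin n) (Fin q₂) ℝ :=
  -(G.A * Y * G.C₂.transpose * (G.Ψ Y)⁻¹)

/-- `X` is the stabilizing solution of the control Riccati equation. -/
structure IsControlRiccati (X : Matrix (Fin n) (Fin n) ℝ) : Prop where
  symm : X.transpose = X
  eq : X = G.C₁.transpose * G.C₁ + G.A.transpose * X * G.A
    - G.A.transpose * X * G.B₂ * (G.Ω X)⁻¹ * G.B₂.transpose * X * G.A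
  stable : IsStableMatrix (G.A + G.B₂ * G.gainK X)

/-- `Y` is the stabilizing solution of the filtering Riccati equation. -/
structure IsFilterRiccati (Y : Matrix (Fin n) (Fin n) ℝ) : Prop where
  symm : Y.transpose = Y
  eq : Y = G.B₁ * G.B₁.transpose + G.A * Y * G.A.transpose
    - G.A * Y * G.C₂.transpose * (G.Ψ Y)⁻¹ * G.C₂ * Y * G.A.transpose
  stable : IsStableMatrix (G.A + G.gainL Y * G.C₂)

/-! ### The doubly-coprime factorization of `G₂₂` and the model matching data

`X` and `Y` are the Riccati solutions; `K` and `L` below are the gains. -/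

variable (X Y : Matrix (Fin n) (Fin n) ℝ)

def AK : Matrix (Fin n) (Fin n) ℝ := G.A + G.B₂ * G.gainK X
def AL : Matrix (Fin n) (Fin n) ℝ := G.A + G.gainL Y * G.C₂

def Mhat : TF p₂ p₂ := realization (G.AK X) G.B₂ (G.gainK X) 1
def Nhat : TF q₂ p₂ := realization (G.AK X) G.B₂ G.C₂ 0
def Yhat : TF p₂ q₂ := realization (G.AK X) (-(G.gainL Y)) (G.gainK X) 0
def Xhat : TF q₂ q₂ := realization (G.AK X) (-(G.gainL Y)) G.C₂ 1
def Mtilde : TF q₂ q₂ := realization (G.AL Y) (-(G.gainL Y)) (-G.C₂) 1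

/-- `P₁₁ = G₁₁ + G₁₂ Ŷ M̃ G₂₁`. -/
def P₁₁ : TF q₁ p₁ := G.G₁₁ + G.G₁₂ * G.Yhat X Y * G.Mtilde Y * G.G₂₁

/-- The controller `(Ŷ - M̂ V)(X̂ - N̂ V)⁻¹`. -/
def controller (V : TF p₂ q₂) : TF p₂ q₂ :=
  (G.Yhat X Y - G.Mhat X * V) * (G.Xhat X Y - G.Nhat X * V)⁻¹

end Plant

/-! ### FIR spaces and the delay pattern -/

/-- The projection onto `⨁_{i=1}^N z⁻ⁱ ℝ^{p × q}`. -/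
def projFIR {p q : ℕ} (N : ℕ) (G : TF p q) : TF p q :=
  ofCoeffs fun i => if 1 ≤ i ∧ i ≤ N then coeffMat i G else 0

/-- The strictly proper FIR transfer matrices `⨁_{i=1}^N z⁻ⁱ ℝ^{p × q}`. -/
def strictFIR (p q N : ℕ) : Set (TF p q) :=
  {V | ∀ i, ¬ (1 ≤ i ∧ i ≤ N) → coeffMat i V = 0}

/-- `𝒴 = ⨁_{i=1}^N z⁻ⁱ 𝒴ᵢ`. -/
def patternFIR {p q : ℕ} (N : ℕ) (𝒴 : ℕ → Submodule ℝ (Matrix (Fin p) (Fin q) ℝ)) : Set (TF p q) :=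
  {V | V ∈ strictFIR p q N ∧ ∀ i, 1 ≤ i → i ≤ N → coeffMat i V ∈ 𝒴 i}

/-- The constraint space `𝒮 = 𝒴 ⊕ z^{-(N+1)} ℛ_p`. -/
def delaySpace {p q : ℕ} (N : ℕ) (𝒴 : ℕ → Submodule ℝ (Matrix (Fin p) (Fin q) ℝ)) : Set (TF p q) :=
  {K | ∃ V ∈ patternFIR N 𝒴, ∃ W : TF p q, IsProperRational W ∧
    K = V + (PowerSeries.X : PowerSeries ℝ) ^ (N + 1) • W}

/-- Quadratic invariance of `𝒮` with respect to `G`. -/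
def QuadraticallyInvariant {p q : ℕ} (𝒮 : Set (TF p q)) (G : TF q p) : Prop :=
  ∀ K ∈ 𝒮, K * G * K ∈ 𝒮

/-! ### The quadratic program -/

/-- The positive semidefinite square root of a positive semidefinite real matrix. -/
def sqrtMat {ι : Type} [Fintype ι] [DecidableEq ι] (A : Matrix ι ι ℝ) : Matrix ι ι ℝ :=
  open scoped MatrixOrder in CFC.sqrt A

namespace Plant

variable {n p₁ p₂ q₁ q₂ : ℕ} (G : Plant n p₁ p₂ q₁ q₂) (X Y : Matrix (Fin n) (Fin n) ℝ)

/-- The feasible set of the quadratic program: `V` strictly proper FIR such that the projection of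
`(Ŷ - M̂ V) M̃` lies in `𝒴`. -/
def qpFeasible (N : ℕ) (𝒴 : ℕ → Submodule ℝ (Matrix (Fin p₂) (Fin q₂) ℝ)) : Set (TF p₂ q₂) :=
  {V | V ∈ strictFIR p₂ q₂ N ∧
    projFIR N ((G.Yhat X Y - G.Mhat X * V) * G.Mtilde Y) ∈ patternFIR N 𝒴}

/-- The objective `‖Ω^{1/2} V Ψ^{1/2}‖²` of the quadratic program. -/
def qpCost (V : TF p₂ q₂) : ENNReal :=
  h2NormSq (const (sqrtMat (G.Ω X)) * V * const (sqrtMat (G.Ψ Y)))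

end Plant

/-! ### Time-varying finite-horizon LQR -/

/-- A time-varying linear system `x_{i+1} = Aᵢ xᵢ + Bᵢ uᵢ` with cost `∑ᵢ |Cᵢ xᵢ + Dᵢ uᵢ|²`; the input
at time `i` has dimension `d i`. -/
structure TVSystem (σ ρ : Type) (d : ℕ → ℕ) where
  A : ℕ → Matrix σ σ ℝ
  B : (i : ℕ) → Matrix σ (Fin (d i)) ℝ
  C : ℕ → Matrix ρ σ ℝ
  D : (i : ℕ) → Matrix ρ (Fin (d i)) ℝ

namespace TVSystem

variable {σ ρ : Type} [Fintype σ] [Fintype ρ] {d : ℕ → ℕ} (T : TVSystem σ ρ d)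

/-- One step of the backward Riccati recursion, from `X_{i+1} = P` to `Xᵢ`. -/
def riccatiStep (i : ℕ) (P : Matrix σ σ ℝ) : Matrix σ σ ℝ :=
  (T.C i).transpose * T.C i + (T.A i).transpose * P * T.A i
    - ((T.A i).transpose * P * T.B i + (T.C i).transpose * T.D i)
      * ((T.D i).transpose * T.D i + (T.B i).transpose * P * T.B i)⁻¹
      * ((T.B i).transpose * P * T.A i + (T.D i).transpose * T.C i)

/-- The backward recursion on the horizon `1, …, N`: `T.riccati N i = Xᵢ`, with `X_{N+1} = 0`. -/
def riccati (N i : ℕ) : Matrix σ σ ℝ :=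
  if i ≤ N then T.riccatiStep i (riccati N (i + 1)) else 0
termination_by N + 1 - i

/-- The gain `Kᵢ = -(Dᵢᵀ Dᵢ + Bᵢᵀ X_{i+1} Bᵢ)⁻¹ (Bᵢᵀ X_{i+1} Aᵢ + Dᵢᵀ Cᵢ)`. -/
def gain (N i : ℕ) : Matrix (Fin (d i)) σ ℝ :=
  -(((T.D i).transpose * T.D i + (T.B i).transpose * T.riccati N (i + 1) * T.B i)⁻¹
    * ((T.B i).transpose * T.riccati N (i + 1) * T.A i + (T.D i).transpose * T.C i))

/-- The closed-loop trajectory `x_{i+1} = (Aᵢ + Bᵢ Kᵢ) xᵢ` started at time `1` from `x₁ = ξ`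
(the value at time `0` is a placeholder). -/
def trajectory (N : ℕ) (ξ : σ → ℝ) : ℕ → σ → ℝ
  | 0 => 0
  | 1 => ξ
  | i + 2 => (T.A (i + 1) + T.B (i + 1) * T.gain N (i + 1)).mulVec (trajectory N ξ (i + 1))

end TVSystem

/-! ### Vectorization -/

/-- The index type of `vec` of a `p × q` matrix (columns stacked). -/
abbrev VecIdx (p q : ℕ) := Fin q × Fin p

/-- The columns of `E` form an orthonormal basis of the set of vectors `W`. -/
def IsOrthonormalBasisOf {ι κ : Type} [Fintype ι] [DecidableEq κ] (E : Matrix ι κ ℝ)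
    (W : Set (ι → ℝ)) : Prop :=
  E.transpose * E = 1 ∧ (Submodule.span ℝ (Set.range E.col) : Set (ι → ℝ)) = W

/-- `vec(𝒴ᵢ)`. -/
def vecSet {p q : ℕ} (U : Submodule ℝ (Matrix (Fin p) (Fin q) ℝ)) : Set (VecIdx p q → ℝ) :=
  {v | ∃ M ∈ U, v = M.vec}

/-- `vec(𝒴ᵢ^⊥)`, where `⊥` is the complement for the inner product `Tr(M Zᵀ)`. -/
def vecPerpSet {p q : ℕ} (U : Submodule ℝ (Matrix (Fin p) (Fin q) ℝ)) : Set (VecIdx p q → ℝ) :=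
  {v | ∃ M : Matrix (Fin p) (Fin q) ℝ, (∀ Z ∈ U, (M * Z.transpose).trace = 0) ∧ v = M.vec}

namespace Plant

variable {n p₁ p₂ q₁ q₂ : ℕ} (G : Plant n p₁ p₂ q₁ q₂) (X Y : Matrix (Fin n) (Fin n) ℝ)

/-- The index type of the vectorized state. -/
abbrev VecState (n p₂ q₂ : ℕ) := (Fin q₂ × Fin n) ⊕ (Fin n × Fin p₂)

/-- `R = Ψ ⊗ Ω`. -/
def vecR : Matrix (VecIdx p₂ q₂) (VecIdx p₂ q₂) ℝ := G.Ψ Y ⊗ₖ G.Ω X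

def Av : Matrix (VecState n p₂ q₂) (VecState n p₂ q₂) ℝ :=
  Matrix.fromBlocks
    ((1 : Matrix (Fin q₂) (Fin q₂) ℝ) ⊗ₖ G.AK X) 0
    (G.C₂.transpose ⊗ₖ G.gainK X) ((G.AL Y).transpose ⊗ₖ (1 : Matrix (Fin p₂) (Fin p₂) ℝ))

def Bv : Matrix (VecState n p₂ q₂) (VecIdx p₂ q₂) ℝ :=
  Matrix.fromRows
    ((1 : Matrix (Fin q₂) (Fin q₂) ℝ) ⊗ₖ G.B₂)
    (G.C₂.transpose ⊗ₖ (1 : Matrix (Fin p₂) (Fin p₂) ℝ))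

def Cv : Matrix (VecIdx p₂ q₂) (VecState n p₂ q₂) ℝ :=
  Matrix.fromCols
    ((1 : Matrix (Fin q₂) (Fin q₂) ℝ) ⊗ₖ G.gainK X)
    ((G.gainL Y).transpose ⊗ₖ (1 : Matrix (Fin p₂) (Fin p₂) ℝ))

/-- The initial state `x₁ = [vec(L); 0]`. -/
def vecInit : VecState n p₂ q₂ → ℝ := Sum.elim (G.gainL Y).vec 0

/-- The time-varying matrices
`Aᵢ = A_v - B_v Fᵢ Fᵢᵀ C_v`, `Bᵢ = B_v Eᵢ`, `Cᵢ = -R^{1/2} Fᵢ Fᵢᵀ C_v`, `Dᵢ = R^{1/2} Eᵢ`. -/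
def vecSystem {e f : ℕ → ℕ} (E : (i : ℕ) → Matrix (VecIdx p₂ q₂) (Fin (e i)) ℝ)
    (F : (i : ℕ) → Matrix (VecIdx p₂ q₂) (Fin (f i)) ℝ) :
    TVSystem (VecState n p₂ q₂) (VecIdx p₂ q₂) e where
  A i := G.Av X Y - G.Bv * F i * (F i).transpose * G.Cv X Y
  B i := G.Bv * E i
  C i := -(sqrtMat (G.vecR X Y) * F i * (F i).transpose * G.Cv X Y)
  D i := sqrtMat (G.vecR X Y) * E i

end Plant

end DelayHTwo

end

noncomputable section

namespace DelayHTwo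

open Matrix

/-! ### Coefficients of transfer matrices -/

section Coefficients

variable {l m n : ℕ}

/-! A controller enters the closed loop only through `Q = K (I - G₂₂ K)⁻¹`. Quadratic invariance
allows passing between `K` and `Q` inside the delay space in both directions: `feedback_mem` is used
for `G₂₂` and for `-G₂₂`. Every `Q` can be written as `(Ŷ - M̂ V) M̃`, because `M̂` and `M̃` have
constant coefficient `1` and are invertible over power series. In terms of `V` the closed loop is
affine, `P₁₁ - N₁₂ V N₂₁`.

The Riccati equations decouple the cost: `h2NormSq_P₁₁_sub` splits it into `‖P₁₁‖²` and the weighted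
norm of `V`. The splitting comes from a time-domain energy balance, `h2NormSq_sub_realization_mul`,
in which a quadratic storage function telescopes along the state trajectory. It is used with storage
`X` for the plant and with storage `Y` for the transposed plant, and `P₁₁_eq` links the two.
Conversely, `N₁₂` and `N₂₁` have absolutely summable one-sided inverses, so a finite cost forces `V`
into `H₂` (`isH2_of_isH2_P₁₁_sub`), and the lower bound needs no stability assumption on `K`.

The pattern restricts only the coefficients of `Q` up to order `N`. Once `V` has no constant term,
these depend by causality only on the coefficients of `V` of orders `1` to `N`, while later
coefficients can only add cost. Truncation therefore reduces the problem to the quadratic program,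
and an FIR `V` is stable, so the coprime factors give internal stability.

In the quadratic program the map from `V` to `Q` is a state recursion on vectorized matrices.
Requiring the `i`-th coefficient of `Q` to lie in `𝒴ᵢ` fixes the `Fᵢ`-component of `vec Vᵢ` as a
linear feedback of the state and leaves the `Eᵢ`-component free. What remains is unconstrained
finite-horizon linear-quadratic control. Completing squares (`sum_cost_eq`) writes every cost as the
optimal value plus positive definite deviations, which gives the value, the minimizer and its
uniqueness. -/

@[simp] lemma coeffMat_apply (i : ℕ) (G : TF m n) (a : Fin m) (b : Fin n) :
    coeffMat i G a b = PowerSeries.coeff i (G a b) := rfl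

lemma TF.ext_coeffMat {F G : TF m n} (h : ∀ i, coeffMat i F = coeffMat i G) : F = G := by
  ext a b i
  exact congrFun (congrFun (h i) a) b

@[simp] lemma coeffMat_ofCoeffs (i : ℕ) (c : ℕ → Matrix (Fin m) (Fin n) ℝ) :
    coeffMat i (ofCoeffs c) = c i := by
  ext a b
  simp [ofCoeffs]

@[simp] lemma coeffMat_zero (i : ℕ) : coeffMat i (0 : TF m n) = 0 := by ext; simp

lemma coeffMat_add (i : ℕ) (F G : TF m n) :
    coeffMat i (F + G) = coeffMat i F + coeffMat i G := by ext; simp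

lemma coeffMat_sub (i : ℕ) (F G : TF m n) :
    coeffMat i (F - G) = coeffMat i F - coeffMat i G := by ext; simp

lemma coeffMat_neg (i : ℕ) (F : TF m n) : coeffMat i (-F) = -coeffMat i F := by ext; simp

lemma coeffMat_sum {ι : Type*} (s : Finset ι) (i : ℕ) (F : ι → TF m n) :
    coeffMat i (∑ j ∈ s, F j) = ∑ j ∈ s, coeffMat i (F j) := by
  ext; simp [Matrix.sum_apply]

lemma coeffMat_const (i : ℕ) (D : Matrix (Fin m) (Fin n) ℝ) :
    coeffMat i (const D) = if i = 0 then D else 0 := by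
  ext a b
  simp only [coeffMat_apply, const, Matrix.map_apply, PowerSeries.coeff_C]
  split_ifs <;> rfl

@[simp] lemma coeffMat_zero_const (D : Matrix (Fin m) (Fin n) ℝ) :
    coeffMat 0 (const D) = D := by simp [coeffMat_const]

lemma coeffMat_mul (i : ℕ) (F : TF l m) (G : TF m n) :
    coeffMat i (F * G) =
      ∑ p ∈ Finset.HasAntidiagonal.antidiagonal i, coeffMat p.1 F * coeffMat p.2 G := by
  ext a b
  simp only [coeffMat_apply, Matrix.mul_apply, map_sum, PowerSeries.coeff_mul, Matrix.sum_apply]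
  exact Finset.sum_comm

lemma coeffMat_zero_mul (F : TF l m) (G : TF m n) :
    coeffMat 0 (F * G) = coeffMat 0 F * coeffMat 0 G := by
  simp [coeffMat_mul]

lemma coeffMat_const_mul (i : ℕ) (D : Matrix (Fin l) (Fin m) ℝ) (G : TF m n) :
    coeffMat i (const D * G) = D * coeffMat i G := by
  ext a b
  simp [Matrix.mul_apply, const, PowerSeries.coeff_C_mul]

lemma coeffMat_mul_const (i : ℕ) (F : TF l m) (D : Matrix (Fin m) (Fin n) ℝ) :
    coeffMat i (F * const D) = coeffMat i F * D := by
  ext a b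
  simp [Matrix.mul_apply, const, PowerSeries.coeff_mul_C]

lemma coeffMat_zero_X_smul (G : TF m n) :
    coeffMat 0 ((PowerSeries.X : PowerSeries ℝ) • G) = 0 := by
  ext; simp

lemma coeffMat_succ_X_smul (i : ℕ) (G : TF m n) :
    coeffMat (i + 1) ((PowerSeries.X : PowerSeries ℝ) • G) = coeffMat i G := by
  ext; simp [PowerSeries.coeff_succ_X_mul]

lemma coeffMat_X_pow_smul_of_lt {i k : ℕ} (h : i < k) (G : TF m n) :
    coeffMat i ((PowerSeries.X : PowerSeries ℝ) ^ k • G) = 0 := by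
  ext; simp [PowerSeries.coeff_X_pow_mul', h]

lemma coeffMat_transpose (i : ℕ) (G : TF m n) :
    coeffMat i Gᵀ = (coeffMat i G)ᵀ := rfl

@[simp] lemma coeffMat_zero_one : coeffMat 0 (1 : TF n n) = 1 := by
  ext a b
  by_cases h : a = b <;> simp [h, Matrix.one_apply]

lemma const_mul (A : Matrix (Fin l) (Fin m) ℝ) (B : Matrix (Fin m) (Fin n) ℝ) :
    const (A * B) = const A * const B := by
  simp [const, Matrix.map_mul]

lemma const_add (A B : Matrix (Fin m) (Fin n) ℝ) : const (A + B) = const A + const B := by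
  ext; simp [const]

lemma const_sub (A B : Matrix (Fin m) (Fin n) ℝ) : const (A - B) = const A - const B := by
  ext; simp [const]

lemma const_neg (A : Matrix (Fin m) (Fin n) ℝ) : const (-A) = -const A := by
  ext; simp [const]

@[simp] lemma const_zero : const (0 : Matrix (Fin m) (Fin n) ℝ) = 0 := by
  ext; simp [const]

@[simp] lemma const_one : const (1 : Matrix (Fin n) (Fin n) ℝ) = 1 := by
  simp [const]

lemma const_transpose (A : Matrix (Fin m) (Fin n) ℝ) : (const A)ᵀ = const Aᵀ := rfl

/-- A power series is a unit as soon as its constant coefficient is. This makes the matrix inverses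
of the feedback formulas and coprime factors genuine inverses, not default values. -/
lemma isUnit_det_of_coeffMat_zero {M : TF n n} (h : coeffMat 0 M = 1) : IsUnit M.det := by
  rw [PowerSeries.isUnit_iff_constantCoeff, RingHom.map_det]
  have : (PowerSeries.constantCoeff (R := ℝ)).mapMatrix M = 1 := by
    rw [← h]; ext; simp
  simp [this]

end Coefficients

/-! ### Transfer matrices with entries in a subring -/

section Subrings

variable {l m n : ℕ}

/-- All entries of `G` lie in `S`. -/
def EntriesIn (S : Subring (PowerSeries ℝ)) (G : TF m n) : Prop := ∀ a b, G a b ∈ S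

namespace EntriesIn

variable {S : Subring (PowerSeries ℝ)}

lemma one : EntriesIn S (1 : TF n n) := fun a b => by
  rw [Matrix.one_apply]; split_ifs; exacts [S.one_mem, S.zero_mem]

lemma add {F G : TF m n} (hF : EntriesIn S F) (hG : EntriesIn S G) : EntriesIn S (F + G) :=
  fun a b => S.add_mem (hF a b) (hG a b)

lemma sub {F G : TF m n} (hF : EntriesIn S F) (hG : EntriesIn S G) : EntriesIn S (F - G) :=
  fun a b => S.sub_mem (hF a b) (hG a b)

lemma neg {F : TF m n} (hF : EntriesIn S F) : EntriesIn S (-F) :=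
  fun a b => S.neg_mem (hF a b)

lemma mul {F : TF l m} {G : TF m n} (hF : EntriesIn S F) (hG : EntriesIn S G) :
    EntriesIn S (F * G) :=
  fun a b => by
    rw [Matrix.mul_apply]
    exact S.sum_mem fun c _ => S.mul_mem (hF a c) (hG c b)

lemma smul {c : PowerSeries ℝ} {F : TF m n} (hc : c ∈ S) (hF : EntriesIn S F) :
    EntriesIn S (c • F) := fun a b => S.mul_mem hc (hF a b)

lemma transpose {F : TF m n} (hF : EntriesIn S F) : EntriesIn S Fᵀ := fun a b => hF b a

/-- Lifting to a matrix over the subring itself makes closure under determinants and adjugates a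
consequence of their compatibility with ring homomorphisms. -/
lemma exists_map {M : TF n n} (hM : EntriesIn S M) :
    ∃ M' : Matrix (Fin n) (Fin n) S, S.subtype.mapMatrix M' = M :=
  ⟨Matrix.of fun a b => ⟨M a b, hM a b⟩, by ext; simp⟩

lemma det {M : TF n n} (hM : EntriesIn S M) : M.det ∈ S := by
  obtain ⟨M', rfl⟩ := hM.exists_map
  rw [← RingHom.map_det]
  exact M'.det.2

lemma adjugate {M : TF n n} (hM : EntriesIn S M) : EntriesIn S M.adjugate := by
  obtain ⟨M', rfl⟩ := hM.exists_map
  rw [← RingHom.map_adjugate]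
  exact fun a b => (M'.adjugate a b).2

end EntriesIn

/-- Power series of the form `p / q` with polynomials `p` and `q ∈ S`. -/
def fractionSubring (S : Submonoid (Polynomial ℝ)) : Subring (PowerSeries ℝ) where
  carrier := {f | ∃ p q : Polynomial ℝ, q ∈ S ∧ (q : PowerSeries ℝ) * f = (p : PowerSeries ℝ)}
  zero_mem' := ⟨0, 1, S.one_mem, by simp⟩
  one_mem' := ⟨1, 1, S.one_mem, by simp⟩
  add_mem' := by
    rintro f g ⟨p, q, hq, h⟩ ⟨p', q', hq', h'⟩
    refine ⟨q' * p + q * p', q * q', S.mul_mem hq hq', ?_⟩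
    push_cast
    rw [← h, ← h']; ring
  mul_mem' := by
    rintro f g ⟨p, q, hq, h⟩ ⟨p', q', hq', h'⟩
    refine ⟨p * p', q * q', S.mul_mem hq hq', ?_⟩
    push_cast
    rw [← h, ← h']; ring
  neg_mem' := by
    rintro f ⟨p, q, hq, h⟩
    exact ⟨-p, q, hq, by push_cast; rw [← h]; ring⟩

lemma coe_mem_fractionSubring (S : Submonoid (Polynomial ℝ)) (p : Polynomial ℝ) :
    (p : PowerSeries ℝ) ∈ fractionSubring S := ⟨p, 1, S.one_mem, by simp⟩

/-- Polynomials in `1/z` that do not vanish at `z = ∞`. -/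
def properDenominators : Submonoid (Polynomial ℝ) where
  carrier := {q | q.coeff 0 ≠ 0}
  one_mem' := by simp
  mul_mem' := by
    intro p q hp hq
    simpa [Polynomial.mul_coeff_zero] using And.intro hp hq

/-- Polynomials in `1/z` that do not vanish for `|z| ≥ 1`. -/
def stableDenominators : Submonoid (Polynomial ℝ) where
  carrier := {q | ∀ w : ℂ, ‖w‖ ≤ 1 → Polynomial.aeval w q ≠ 0}
  one_mem' := by simp
  mul_mem' := by
    intro p q hp hq w hw
    rw [map_mul]
    exact mul_ne_zero (hp w hw) (hq w hw)

lemma isStableTF_iff {G : TF m n} :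
    IsStableTF G ↔ EntriesIn (fractionSubring stableDenominators) G := Iff.rfl

lemma entriesIn_const (S : Submonoid (Polynomial ℝ)) (D : Matrix (Fin m) (Fin n) ℝ) :
    EntriesIn (fractionSubring S) (const D) := fun a b => by
  simpa [const] using coe_mem_fractionSubring S (Polynomial.C (D a b))

lemma X_mem_fractionSubring (S : Submonoid (Polynomial ℝ)) :
    (PowerSeries.X : PowerSeries ℝ) ∈ fractionSubring S := by
  simpa using coe_mem_fractionSubring S Polynomial.X

/-- Inversion swaps numerator and denominator. The old numerator is an admissible denominator
because its constant term is a product of two nonzero numbers. -/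
lemma mem_properRing_of_mul_eq_one {f g : PowerSeries ℝ}
    (hf : f ∈ fractionSubring properDenominators) (h : f * g = 1) :
    g ∈ fractionSubring properDenominators := by
  obtain ⟨p, q, hq, e⟩ := hf
  refine ⟨q, p, ?_, ?_⟩
  · have h0 := congrArg PowerSeries.constantCoeff h
    have h1 := congrArg PowerSeries.constantCoeff e
    simp only [map_mul, map_one, Polynomial.constantCoeff_coe] at h0 h1
    have hq' : q.coeff 0 ≠ 0 := hq
    change p.coeff 0 ≠ 0
    rw [← h1]
    exact mul_ne_zero hq' (left_ne_zero_of_mul_eq_one h0)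
  · rw [← e, mul_assoc, h, mul_one]

/-- Cramer's rule: the adjugate stays in the subring, and the determinant is a unit of it. -/
lemma EntriesIn.inv {M : TF n n} (hM : EntriesIn (fractionSubring properDenominators) M)
    (h0 : coeffMat 0 M = 1) : EntriesIn (fractionSubring properDenominators) M⁻¹ := by
  have hu := isUnit_det_of_coeffMat_zero h0
  rw [Matrix.inv_def]
  exact hM.adjugate.smul <|
    mem_properRing_of_mul_eq_one hM.det (Ring.mul_inverse_cancel _ hu)

/-- If `M` has finitely many nonzero coefficients, its entries are polynomials in `1/z`. -/
lemma entriesIn_of_coeffMat_eq_zero (S : Submonoid (Polynomial ℝ)) {M : TF m n} {N : ℕ}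
    (h : ∀ i, N < i → coeffMat i M = 0) : EntriesIn (fractionSubring S) M := by
  intro a b
  have : M a b = (PowerSeries.trunc (N + 1) (M a b) : Polynomial ℝ) := by
    ext i
    rw [Polynomial.coeff_coe, PowerSeries.coeff_trunc]
    split_ifs with hi
    · rfl
    · exact congrFun (congrFun (h i (by omega)) a) b
  rw [this]
  exact coe_mem_fractionSubring S _

end Subrings

/-! ### Summable and square-summable transfer matrices -/

section Summability

variable {l m n : ℕ}

/-- Power series with absolutely summable coefficients. -/
def summableSubring : Subring (PowerSeries ℝ) where
  carrier := {f | Summable fun i => ‖PowerSeries.coeff i f‖}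
  zero_mem' := by simp [summable_zero]
  one_mem' := summable_of_ne_finset_zero (s := {0}) fun i hi => by
    simp only [Finset.mem_singleton] at hi
    simp [PowerSeries.coeff_one, hi]
  add_mem' := fun {f g} hf hg => by
    refine Summable.of_nonneg_of_le (fun _ => norm_nonneg _) (fun i => ?_) (hf.add hg)
    rw [map_add]; exact norm_add_le _ _
  mul_mem' := fun {f g} hf hg => by
    simpa [PowerSeries.coeff_mul] using
      summable_norm_sum_mul_antidiagonal_of_summable_norm hf hg
  neg_mem' := fun {f} hf => by simpa using hf

lemma mem_summableSubring {f : PowerSeries ℝ} :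
    f ∈ summableSubring ↔ Summable fun i => ‖PowerSeries.coeff i f‖ := Iff.rfl

lemma entriesIn_summable_const (D : Matrix (Fin m) (Fin n) ℝ) :
    EntriesIn summableSubring (const D) := fun a b => by
  refine summable_of_ne_finset_zero (s := {0}) fun i hi => ?_
  simp only [Finset.mem_singleton] at hi
  simp [const, PowerSeries.coeff_C, hi]

/-- Power series with square-summable coefficients. -/
def squareSummable : AddSubgroup (PowerSeries ℝ) where
  carrier := {f | Summable fun i => PowerSeries.coeff i f ^ 2}
  zero_mem' := by simp [summable_zero]
  add_mem' := fun {f g} hf hg => by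
    refine Summable.of_nonneg_of_le (fun _ => sq_nonneg _) (fun i => ?_)
      ((hf.add hg).mul_left 2)
    rw [map_add]
    nlinarith [sq_nonneg (PowerSeries.coeff i f - PowerSeries.coeff i g)]
  neg_mem' := fun {f} hf => by simpa using hf

lemma mem_squareSummable {f : PowerSeries ℝ} :
    f ∈ squareSummable ↔ Summable fun i => PowerSeries.coeff i f ^ 2 := Iff.rfl

/-- Young's inequality `ℓ¹ * ℓ² ⊆ ℓ²`. -/
lemma mul_mem_squareSummable {f g : PowerSeries ℝ} (hf : f ∈ summableSubring)
    (hg : g ∈ squareSummable) : f * g ∈ squareSummable := by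
  have hf' := mem_summableSubring.1 hf
  have hg' : Summable fun i => ‖PowerSeries.coeff i g ^ 2‖ := (mem_squareSummable.1 hg).norm
  have hc := summable_norm_sum_mul_antidiagonal_of_summable_norm
    (f := fun i => ‖PowerSeries.coeff i f‖) (g := fun i => ‖PowerSeries.coeff i g ^ 2‖)
    hf'.norm hg'.norm
  refine Summable.of_nonneg_of_le (fun _ => sq_nonneg _) (fun i => ?_)
    (hc.mul_left (∑' j, ‖PowerSeries.coeff j f‖))
  rw [PowerSeries.coeff_mul]
  calc (∑ p ∈ Finset.HasAntidiagonal.antidiagonal i, PowerSeries.coeff p.1 f * PowerSeries.coeff p.2 g) ^ 2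
      ≤ (∑ p ∈ Finset.HasAntidiagonal.antidiagonal i, ‖PowerSeries.coeff p.1 f‖) *
          ∑ p ∈ Finset.HasAntidiagonal.antidiagonal i,
            ‖PowerSeries.coeff p.1 f‖ * ‖PowerSeries.coeff p.2 g ^ 2‖ := by
        -- Cauchy–Schwarz with the splitting `|f| |g| = |f|^{1/2} · (|f|^{1/2} |g|)`.
        refine Finset.sum_sq_le_sum_mul_sum_of_sq_le_mul _ (fun _ _ => norm_nonneg _)
          (fun _ _ => by positivity) fun p _ => le_of_eq ?_
        rw [mul_pow, Real.norm_eq_abs, Real.norm_eq_abs, abs_of_nonneg (sq_nonneg (PowerSeries.coeff p.2 g)),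
          ← mul_assoc, ← sq, sq_abs]
    _ ≤ _ := by
        refine mul_le_mul ?_ (le_abs_self _) (Finset.sum_nonneg fun _ _ => by positivity)
          (tsum_nonneg fun _ => norm_nonneg _)
        rw [Finset.Nat.sum_antidiagonal_eq_sum_range_succ_mk]
        exact hf'.sum_le_tsum _ fun _ _ => norm_nonneg _

/-- The transfer matrix `G` lies in `H₂`. -/
def IsH2 (G : TF m n) : Prop := ∀ a b, G a b ∈ squareSummable

namespace IsH2

lemma add {F G : TF m n} (hF : IsH2 F) (hG : IsH2 G) : IsH2 (F + G) :=
  fun a b => squareSummable.add_mem (hF a b) (hG a b)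

lemma sub {F G : TF m n} (hF : IsH2 F) (hG : IsH2 G) : IsH2 (F - G) :=
  fun a b => squareSummable.sub_mem (hF a b) (hG a b)

lemma neg {F : TF m n} (hF : IsH2 F) : IsH2 (-F) :=
  fun a b => squareSummable.neg_mem (hF a b)

lemma transpose {F : TF m n} (hF : IsH2 F) : IsH2 Fᵀ := fun a b => hF b a

lemma left_mul {F : TF l m} {G : TF m n} (hF : EntriesIn summableSubring F) (hG : IsH2 G) :
    IsH2 (F * G) :=
  fun a b => by
    rw [Matrix.mul_apply]
    exact squareSummable.sum_mem fun c _ => mul_mem_squareSummable (hF a c) (hG c b)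

lemma right_mul {F : TF l m} {G : TF m n} (hF : IsH2 F) (hG : EntriesIn summableSubring G) :
    IsH2 (F * G) := by
  rw [← Matrix.transpose_transpose (F * G), Matrix.transpose_mul]
  exact (left_mul hG.transpose hF.transpose).transpose

lemma of_summable {G : TF m n} (hG : EntriesIn summableSubring G) : IsH2 G := fun a b => by
  -- The inclusion `ℓ¹ ⊆ ℓ²` is Young's inequality with the identity as the second factor.
  have h : IsH2 (1 : TF n n) := fun a b => by
    refine summable_of_ne_finset_zero (s := {0}) fun i hi => ?_
    simp only [Finset.mem_singleton] at hi
    by_cases hab : a = b <;> simp [hab, Matrix.one_apply, PowerSeries.coeff_one, hi]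
  simpa using left_mul hG h a b

lemma tendsto_zero {G : TF m n} (hG : IsH2 G) (a : Fin m) (b : Fin n) :
    Filter.Tendsto (fun i => coeffMat i G a b) Filter.atTop (nhds 0) := by
  have h := (mem_squareSummable.1 (hG a b)).tendsto_atTop_zero
  have h' := h.sqrt
  simp only [Real.sqrt_sq_eq_abs, Real.sqrt_zero] at h'
  exact (tendsto_zero_iff_abs_tendsto_zero _).2 h'

end IsH2

lemma trace_mul_transpose_self_nonneg (M : Matrix (Fin m) (Fin n) ℝ) : 0 ≤ (M * Mᵀ).trace := by
  rw [Matrix.trace]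
  exact Finset.sum_nonneg fun a _ => by
    simp only [Matrix.diag_apply, Matrix.mul_apply, Matrix.transpose_apply]
    exact Finset.sum_nonneg fun b _ => mul_self_nonneg _

lemma trace_mul_transpose_self_eq (M : Matrix (Fin m) (Fin n) ℝ) :
    (M * Mᵀ).trace = ∑ a, ∑ b, M a b ^ 2 := by
  simp [Matrix.trace, Matrix.mul_apply, sq]

lemma isH2_iff_summable_trace {G : TF m n} :
    IsH2 G ↔ Summable fun i => (coeffMat i G * (coeffMat i G)ᵀ).trace := by
  simp_rw [trace_mul_transpose_self_eq]
  constructor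
  · intro h
    exact summable_sum fun a _ => summable_sum fun b _ => h a b
  · intro h a b
    refine Summable.of_nonneg_of_le (fun _ => sq_nonneg _) (fun i => ?_) h
    calc PowerSeries.coeff i (G a b) ^ 2 ≤ ∑ b', coeffMat i G a b' ^ 2 :=
          Finset.single_le_sum (f := fun b' => coeffMat i G a b' ^ 2)
            (fun _ _ => sq_nonneg _) (Finset.mem_univ b)
      _ ≤ _ := Finset.single_le_sum (f := fun a' => ∑ b', coeffMat i G a' b' ^ 2)
            (fun _ _ => Finset.sum_nonneg fun _ _ => sq_nonneg _) (Finset.mem_univ a)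

lemma isH2_iff_h2NormSq_ne_top {G : TF m n} : IsH2 G ↔ h2NormSq G ≠ ⊤ := by
  rw [isH2_iff_summable_trace]
  constructor
  · intro h
    exact h.tsum_ofReal_ne_top
  · intro h
    have := ENNReal.summable_toReal h
    simpa [ENNReal.toReal_ofReal, trace_mul_transpose_self_nonneg] using this

lemma IsH2.h2NormSq_eq {G : TF m n} (h : IsH2 G) :
    h2NormSq G = ENNReal.ofReal (∑' i, (coeffMat i G * (coeffMat i G)ᵀ).trace) :=
  (ENNReal.ofReal_tsum_of_nonneg (fun _ => trace_mul_transpose_self_nonneg _)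
    (isH2_iff_summable_trace.1 h)).symm

lemma h2NormSq_transpose (G : TF m n) : h2NormSq Gᵀ = h2NormSq G := by
  unfold h2NormSq
  congr 1; ext i
  rw [coeffMat_transpose, Matrix.transpose_transpose, Matrix.trace_mul_comm]

end Summability

/-! ### Stable matrices -/

section StableMatrix

variable {k l m n : ℕ}

section PowerBound

open scoped NNReal ENNReal

attribute [local instance] Matrix.linftyOpNormedRing Matrix.linftyOpNormedAlgebra


/-- Gelfand's formula: for a radius `r < 1` above the spectral radius, `‖Aⁱ‖ ≤ rⁱ` eventually. The
size `k + 1` keeps the matrix algebra nontrivial; the empty matrix is treated separately below. -/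
lemma summable_norm_pow_of_spectrum_lt {A : Matrix (Fin (k + 1)) (Fin (k + 1)) ℂ}
    (hA : ∀ μ ∈ spectrum ℂ A, ‖μ‖ < 1) : Summable fun i => ‖A ^ i‖ := by
  have hr : spectralRadius ℂ A < (1 : ℝ≥0) :=
    spectrum.spectralRadius_lt_of_forall_lt A fun μ hμ => hA μ hμ
  obtain ⟨r, hr1, hr2⟩ := ENNReal.lt_iff_exists_nnreal_btwn.1 hr
  have ht := spectrum.pow_nnnorm_pow_one_div_tendsto_nhds_spectralRadius A
  have hev := ht.eventually (gt_mem_nhds hr1)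
  have hr2' : (r : ℝ) < 1 := by exact_mod_cast hr2
  refine Summable.of_norm_bounded_eventually_nat
    (summable_geometric_of_lt_one r.2 hr2') ?_
  filter_upwards [hev, Filter.eventually_gt_atTop 0] with i hi hi0
  have h1 : (‖A ^ i‖₊ : ℝ≥0∞) ≤ (r : ℝ≥0∞) ^ i := by
    have := ENNReal.rpow_le_rpow hi.le (Nat.cast_nonneg i)
    rwa [← ENNReal.rpow_mul, one_div, inv_mul_cancel₀ (by positivity), ENNReal.rpow_one,
      ENNReal.rpow_natCast] at this
  rw [norm_norm]
  exact_mod_cast h1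

lemma IsStableMatrix.summable_pow_apply {A : Matrix (Fin k) (Fin k) ℝ} (hA : IsStableMatrix A)
    (a b : Fin k) : Summable fun i => ‖(A ^ i) a b‖ := by
  cases k with
  | zero => exact a.elim0
  | succ k =>
    refine Summable.of_nonneg_of_le (fun _ => norm_nonneg _) (fun i => ?_)
      (summable_norm_pow_of_spectrum_lt hA)
    have h : ((A.map (algebraMap ℝ ℂ)) ^ i) a b = ((A ^ i) a b : ℝ) := by
      rw [← RingHom.mapMatrix_apply, ← map_pow]; rfl
    have h2 : ‖(A ^ i) a b‖ = ‖((A.map (algebraMap ℝ ℂ)) ^ i) a b‖ := by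
      rw [h, Complex.norm_real]
    rw [h2]
    generalize (A.map (algebraMap ℝ ℂ)) ^ i = M
    rw [← coe_nnnorm, ← coe_nnnorm, NNReal.coe_le_coe, Matrix.linfty_opNNNorm_def]
    exact (Finset.single_le_sum (f := fun b => ‖M a b‖₊) (fun _ _ => zero_le)
      (Finset.mem_univ b)).trans
      (Finset.le_sup (f := fun a => ∑ b, ‖M a b‖₊) (Finset.mem_univ a))

end PowerBound

lemma IsStableMatrix.tendsto_pow {A : Matrix (Fin k) (Fin k) ℝ} (hA : IsStableMatrix A) :
    Filter.Tendsto (fun i => A ^ i) Filter.atTop (nhds 0) := by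
  refine tendsto_pi_nhds.2 fun a => tendsto_pi_nhds.2 fun b => ?_
  exact (hA.summable_pow_apply a b).of_norm.tendsto_atTop_zero

lemma IsStableMatrix.transpose {A : Matrix (Fin k) (Fin k) ℝ} (hA : IsStableMatrix A) :
    IsStableMatrix Aᵀ := by
  intro μ hμ
  apply hA
  rw [spectrum.mem_iff] at hμ ⊢
  contrapose! hμ
  rw [Matrix.isUnit_iff_isUnit_det] at hμ ⊢
  rw [← Matrix.det_transpose]
  convert hμ using 2
  ext a b
  simp [Matrix.algebraMap_matrix_apply, eq_comm]

/-- A solution of the Lyapunov equation of a stable matrix is positive semidefinite. -/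
lemma IsStableMatrix.posSemidef_of_lyapunov {A P : Matrix (Fin k) (Fin k) ℝ}
    (hA : IsStableMatrix A) (hP : Pᵀ = P) {C : Matrix (Fin m) (Fin k) ℝ}
    (h : P = Aᵀ * P * A + Cᵀ * C) : P.PosSemidef := by
  -- Iterating the Lyapunov equation gives `P - (Aⁱ)ᵀ P Aⁱ = ∑_{j<i} (C Aʲ)ᵀ (C Aʲ)`, which is
  -- positive semidefinite. Stability then lets `i → ∞`.
  have key : ∀ i : ℕ, (P - (A ^ i)ᵀ * P * A ^ i).PosSemidef := by
    intro i
    induction i with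
    | zero => simpa using PosSemidef.zero
    | succ i ih =>
      have h1 : P - (A ^ (i + 1))ᵀ * P * A ^ (i + 1) =
          (P - (A ^ i)ᵀ * P * A ^ i) + (C * A ^ i)ᴴ * (C * A ^ i) := by
        have h2 : (A ^ i)ᵀ * P * A ^ i = (A ^ i)ᵀ * (Aᵀ * P * A + Cᵀ * C) * A ^ i := by
          rw [← h]
        rw [h2, pow_succ', conjTranspose_eq_transpose_of_trivial, transpose_mul, transpose_mul]
        simp only [Matrix.mul_add, Matrix.add_mul, Matrix.mul_assoc]
        abel
      rw [h1]
      exact ih.add (posSemidef_conjTranspose_mul_self _)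
  refine PosSemidef.of_dotProduct_mulVec_nonneg ?_ fun x => ?_
  · rw [IsHermitian, conjTranspose_eq_transpose_of_trivial, hP]
  · have ht : Filter.Tendsto (fun i => star x ⬝ᵥ ((P - (A ^ i)ᵀ * P * A ^ i) *ᵥ x)) Filter.atTop
        (nhds (star x ⬝ᵥ ((P - (0 : Matrix (Fin k) (Fin k) ℝ)ᵀ * P * 0) *ᵥ x))) := by
      have hc : Continuous fun M : Matrix (Fin k) (Fin k) ℝ =>
          star x ⬝ᵥ ((P - Mᵀ * P * M) *ᵥ x) := by fun_prop
      exact (hc.tendsto 0).comp hA.tendsto_pow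
    have := ge_of_tendsto' ht fun i => (key i).dotProduct_mulVec_nonneg x
    simpa using this

end StableMatrix

/-! ### Resolvents -/

section Resolvent

variable {k l m n : ℕ}

/-- The transfer matrix `(zI - A)⁻¹`. -/
def resolventTF (A : Matrix (Fin k) (Fin k) ℝ) : TF k k :=
  (PowerSeries.X : PowerSeries ℝ) • (1 - (PowerSeries.X : PowerSeries ℝ) • const A)⁻¹

lemma realization_eq (A : Matrix (Fin k) (Fin k) ℝ) (B : Matrix (Fin k) (Fin n) ℝ)
    (C : Matrix (Fin m) (Fin k) ℝ) (D : Matrix (Fin m) (Fin n) ℝ) :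
    realization A B C D = const C * resolventTF A * const B + const D := rfl

lemma isUnit_det_one_sub (A : Matrix (Fin k) (Fin k) ℝ) :
    IsUnit (1 - (PowerSeries.X : PowerSeries ℝ) • const A).det :=
  isUnit_det_of_coeffMat_zero (by simp [coeffMat_sub, coeffMat_zero_X_smul])

/-- The resolvent identity. -/
lemma resolventTF_sub (A B : Matrix (Fin k) (Fin k) ℝ) :
    resolventTF B - resolventTF A = resolventTF A * const (B - A) * resolventTF B := by
  have hA := Matrix.nonsing_inv_mul _ (isUnit_det_one_sub A)
  have hB := Matrix.mul_nonsing_inv _ (isUnit_det_one_sub B)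
  unfold resolventTF
  set P := (1 - (PowerSeries.X : PowerSeries ℝ) • const A)⁻¹
  set Q := (1 - (PowerSeries.X : PowerSeries ℝ) • const B)⁻¹
  have h1 : Q - P = P * ((PowerSeries.X : PowerSeries ℝ) • const (B - A)) * Q := by
    calc Q - P = (P * (1 - (PowerSeries.X : PowerSeries ℝ) • const A)) * Q -
          P * ((1 - (PowerSeries.X : PowerSeries ℝ) • const B) * Q) := by
          rw [hA, hB, Matrix.one_mul, Matrix.mul_one]
      _ = _ := by rw [const_sub, smul_sub]; noncomm_ring
  rw [← smul_sub, h1]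
  simp only [Matrix.mul_smul, Matrix.smul_mul]

lemma resolventTF_eq (A : Matrix (Fin k) (Fin k) ℝ) :
    resolventTF A = (PowerSeries.X : PowerSeries ℝ) • (1 + const A * resolventTF A) := by
  have hA := Matrix.mul_nonsing_inv _ (isUnit_det_one_sub A)
  unfold resolventTF
  congr 1
  rw [Matrix.sub_mul, Matrix.one_mul, sub_eq_iff_eq_add] at hA
  rw [Matrix.mul_smul, ← Matrix.smul_mul]
  exact hA

lemma resolventTF_eq' (A : Matrix (Fin k) (Fin k) ℝ) :
    resolventTF A = (PowerSeries.X : PowerSeries ℝ) • (1 + resolventTF A * const A) := by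
  have hA := Matrix.nonsing_inv_mul _ (isUnit_det_one_sub A)
  unfold resolventTF
  congr 1
  rw [Matrix.mul_sub, Matrix.mul_one, sub_eq_iff_eq_add] at hA
  rw [Matrix.smul_mul, ← Matrix.mul_smul]
  exact hA

lemma resolventTF_transpose (A : Matrix (Fin k) (Fin k) ℝ) :
    (resolventTF A)ᵀ = resolventTF Aᵀ := by
  unfold resolventTF
  rw [Matrix.transpose_smul, Matrix.transpose_nonsing_inv, Matrix.transpose_sub,
    Matrix.transpose_one, Matrix.transpose_smul, const_transpose]

lemma realization_transpose (A : Matrix (Fin k) (Fin k) ℝ) (B : Matrix (Fin k) (Fin n) ℝ)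
    (C : Matrix (Fin m) (Fin k) ℝ) (D : Matrix (Fin m) (Fin n) ℝ) :
    (realization A B C D)ᵀ = realization Aᵀ Cᵀ Bᵀ Dᵀ := by
  simp only [realization_eq, Matrix.transpose_add, Matrix.transpose_mul, const_transpose,
    resolventTF_transpose, Matrix.mul_assoc]

@[simp] lemma coeffMat_zero_resolventTF (A : Matrix (Fin k) (Fin k) ℝ) :
    coeffMat 0 (resolventTF A) = 0 := coeffMat_zero_X_smul _

lemma coeffMat_succ_resolventTF (A : Matrix (Fin k) (Fin k) ℝ) (i : ℕ) :
    coeffMat (i + 1) (resolventTF A) = A ^ i := by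
  induction i with
  | zero =>
    rw [resolventTF_eq, coeffMat_succ_X_smul]
    simp [coeffMat_add, coeffMat_const_mul]
  | succ i ih =>
    rw [resolventTF_eq, coeffMat_succ_X_smul, coeffMat_add, coeffMat_const_mul, ih, ← pow_succ',
      ← const_one, coeffMat_const]
    simp

@[simp] lemma coeffMat_zero_realization (A : Matrix (Fin k) (Fin k) ℝ)
    (B : Matrix (Fin k) (Fin n) ℝ) (C : Matrix (Fin m) (Fin k) ℝ) (D : Matrix (Fin m) (Fin n) ℝ) :
    coeffMat 0 (realization A B C D) = D := by
  simp [realization_eq, coeffMat_add, coeffMat_mul_const, coeffMat_const_mul]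

lemma IsStableMatrix.entriesIn_summable {A : Matrix (Fin k) (Fin k) ℝ} (hA : IsStableMatrix A) :
    EntriesIn summableSubring (resolventTF A) := fun a b => by
  rw [mem_summableSubring, ← summable_nat_add_iff 1]
  refine (hA.summable_pow_apply a b).congr fun i => ?_
  rw [← coeffMat_succ_resolventTF]; rfl

/-- The resolvent of `A` is a matrix of polynomials in `1/z` divided by `det (1 - z⁻¹ A)`. -/
lemma entriesIn_resolventTF {S : Submonoid (Polynomial ℝ)} {A : Matrix (Fin k) (Fin k) ℝ}
    (hA : A.charpolyRev ∈ S) : EntriesIn (fractionSubring S) (resolventTF A) := by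
  let Q : Matrix (Fin k) (Fin k) (Polynomial ℝ) :=
    1 - (Polynomial.X : Polynomial ℝ) • A.map Polynomial.C
  have hQ : (Polynomial.coeToPowerSeries.ringHom (R := ℝ)).mapMatrix Q =
      1 - (PowerSeries.X : PowerSeries ℝ) • const A := by
    ext1 a b
    by_cases h : a = b <;> simp [Q, const, h] <;> ring
  have h := congrArg (Polynomial.coeToPowerSeries.ringHom (R := ℝ)).mapMatrix
    (Matrix.adjugate_mul Q)
  rw [map_mul, hQ] at h
  have h2 : (Polynomial.coeToPowerSeries.ringHom (R := ℝ)).mapMatrix (Q.det • 1) =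
      (A.charpolyRev : PowerSeries ℝ) • (1 : TF k k) := by
    ext1 a b
    by_cases h : a = b <;> simp [Q, Matrix.charpolyRev, h]
  rw [h2] at h
  have h3 : (A.charpolyRev : PowerSeries ℝ) • (1 - (PowerSeries.X : PowerSeries ℝ) • const A)⁻¹ =
      (Polynomial.coeToPowerSeries.ringHom (R := ℝ)).mapMatrix Q.adjugate := by
    rw [← Matrix.mul_nonsing_inv_cancel_right (A := 1 - (PowerSeries.X : PowerSeries ℝ) • const A)
      ((Polynomial.coeToPowerSeries.ringHom (R := ℝ)).mapMatrix Q.adjugate)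
      (isUnit_det_one_sub A), h, Matrix.smul_mul, Matrix.one_mul]
  refine EntriesIn.smul (X_mem_fractionSubring S) fun a b => ?_
  exact ⟨Q.adjugate a b, A.charpolyRev, hA, congrFun (congrFun h3 a) b⟩

lemma charpolyRev_mem_properDenominators (A : Matrix (Fin k) (Fin k) ℝ) :
    A.charpolyRev ∈ properDenominators := by
  change A.charpolyRev.coeff 0 ≠ 0
  rw [Polynomial.coeff_zero_eq_eval_zero, Matrix.eval_charpolyRev]
  exact one_ne_zero

/-- A zero `w` of `det (1 - w A)` is nonzero and `w⁻¹` is an eigenvalue of `A`, hence `|w| > 1`. -/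
lemma IsStableMatrix.charpolyRev_mem {A : Matrix (Fin k) (Fin k) ℝ} (hA : IsStableMatrix A) :
    A.charpolyRev ∈ stableDenominators := by
  intro w hw h0
  have h1 : Polynomial.aeval w A.charpolyRev =
      (1 - w • A.map (algebraMap ℝ ℂ)).det := by
    rw [Matrix.charpolyRev, AlgHom.map_det]
    congr 1
    ext a b
    by_cases h : a = b <;> simp [h] <;> ring
  rw [h1] at h0
  rcases eq_or_ne w 0 with rfl | hw0
  · simp at h0
  have hmem : w⁻¹ ∈ spectrum ℂ (A.map (algebraMap ℝ ℂ)) := by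
    rw [spectrum.mem_iff, Matrix.isUnit_iff_isUnit_det, isUnit_iff_ne_zero, not_not]
    have h2 : algebraMap ℂ (Matrix (Fin k) (Fin k) ℂ) w⁻¹ - A.map (algebraMap ℝ ℂ) =
        w⁻¹ • (1 - w • A.map (algebraMap ℝ ℂ)) := by
      rw [smul_sub, smul_smul, inv_mul_cancel₀ hw0, one_smul, Algebra.algebraMap_eq_smul_one]
    rw [h2, Matrix.det_smul, h0, mul_zero]
  have := hA _ hmem
  rw [norm_inv] at this
  exact absurd this (not_lt.2 (one_le_inv₀ (norm_pos_iff.2 hw0) |>.2 hw))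

lemma IsStableMatrix.isStableTF_realization {A : Matrix (Fin k) (Fin k) ℝ}
    (hA : IsStableMatrix A) (B : Matrix (Fin k) (Fin n) ℝ) (C : Matrix (Fin m) (Fin k) ℝ)
    (D : Matrix (Fin m) (Fin n) ℝ) :
    EntriesIn (fractionSubring stableDenominators) (realization A B C D) :=
  (((entriesIn_const _ _).mul (entriesIn_resolventTF hA.charpolyRev_mem)).mul
    (entriesIn_const _ _)).add (entriesIn_const _ _)

lemma IsStableMatrix.summable_realization {A : Matrix (Fin k) (Fin k) ℝ}
    (hA : IsStableMatrix A) (B : Matrix (Fin k) (Fin n) ℝ) (C : Matrix (Fin m) (Fin k) ℝ)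
    (D : Matrix (Fin m) (Fin n) ℝ) :
    EntriesIn summableSubring (realization A B C D) :=
  (((entriesIn_summable_const _).mul hA.entriesIn_summable).mul
    (entriesIn_summable_const _)).add (entriesIn_summable_const _)

lemma isProperRational_realization (A : Matrix (Fin k) (Fin k) ℝ)
    (B : Matrix (Fin k) (Fin n) ℝ) (C : Matrix (Fin m) (Fin k) ℝ) (D : Matrix (Fin m) (Fin n) ℝ) :
    EntriesIn (fractionSubring properDenominators) (realization A B C D) :=
  (((entriesIn_const _ _).mul (entriesIn_resolventTF (charpolyRev_mem_properDenominators A))).mul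
    (entriesIn_const _ _)).add (entriesIn_const _ _)

end Resolvent

/-! ### The energy identity -/

section Energy

variable {k m p r s : ℕ}

/-- In the expanded quadratic form the Lyapunov equation turns the state terms into `xᵀ P x`, the
orthogonality condition `h0` kills the cross terms, and `S` factors the input terms. -/
lemma energy_step {A P : Matrix (Fin k) (Fin k) ℝ} (hPs : Pᵀ = P) {B : Matrix (Fin k) (Fin r) ℝ}
    {C : Matrix (Fin m) (Fin k) ℝ} {D : Matrix (Fin m) (Fin r) ℝ} {S : Matrix (Fin s) (Fin r) ℝ}
    (hP : P = Aᵀ * P * A + Cᵀ * C) (h0 : Dᵀ * C + Bᵀ * P * A = 0)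
    (hS : Sᵀ * S = Dᵀ * D + Bᵀ * P * B)
    (x : Matrix (Fin k) (Fin p) ℝ) (u : Matrix (Fin r) (Fin p) ℝ) :
    (C * x - D * u)ᵀ * (C * x - D * u) + (A * x - B * u)ᵀ * P * (A * x - B * u) =
      xᵀ * P * x + (S * u)ᵀ * (S * u) := by
  have h0' : Cᵀ * D + Aᵀ * P * B = 0 := by
    have := congrArg Matrix.transpose h0
    simpa [Matrix.transpose_mul, hPs, Matrix.mul_assoc] using this
  calc _ = xᵀ * (Aᵀ * P * A + Cᵀ * C) * x - xᵀ * (Cᵀ * D + Aᵀ * P * B) * u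
        - uᵀ * (Dᵀ * C + Bᵀ * P * A) * x + uᵀ * (Dᵀ * D + Bᵀ * P * B) * u := by
        simp only [Matrix.transpose_sub, Matrix.transpose_mul, Matrix.mul_add, Matrix.add_mul,
          Matrix.mul_sub, Matrix.sub_mul, Matrix.mul_assoc]
        abel
    _ = _ := by
        rw [← hP, h0, h0', ← hS]
        simp [Matrix.transpose_mul, Matrix.mul_assoc]

/-- For a strictly proper `U` in `H₂`, the output energy of `x⁺ = A x - B u`, `z = C x - D u` with
initial state `B₁` is the sum of the initial storage and of the weighted input energy. -/
theorem h2NormSq_sub_realization_mul {A P : Matrix (Fin k) (Fin k) ℝ} (hA : IsStableMatrix A)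
    (hPs : Pᵀ = P) {B : Matrix (Fin k) (Fin r) ℝ}
    {C : Matrix (Fin m) (Fin k) ℝ} {D : Matrix (Fin m) (Fin r) ℝ} {S : Matrix (Fin s) (Fin r) ℝ}
    (hP : P = Aᵀ * P * A + Cᵀ * C) (h0 : Dᵀ * C + Bᵀ * P * A = 0)
    (hS : Sᵀ * S = Dᵀ * D + Bᵀ * P * B) (B₁ : Matrix (Fin k) (Fin p) ℝ)
    {U : TF r p} (hU : IsH2 U) (hU0 : coeffMat 0 U = 0) :
    h2NormSq (realization A B₁ C 0 - realization A B C D * U) =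
      ENNReal.ofReal (B₁ᵀ * P * B₁).trace + h2NormSq (const S * U) := by
  set Z := realization A B₁ C 0 - realization A B C D * U with hZ
  set ξ := resolventTF A * (const B₁ - const B * U) with hξ
  have hZξ : Z = const C * ξ - const D * U := by
    rw [hZ, hξ, realization_eq, realization_eq, const_zero, add_zero]
    simp only [Matrix.mul_sub, Matrix.add_mul, Matrix.mul_assoc]
    abel
  have hξH : IsH2 ξ := IsH2.left_mul hA.entriesIn_summable
    ((IsH2.of_summable (entriesIn_summable_const _)).sub
      (IsH2.left_mul (entriesIn_summable_const _) hU))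
  have hSU : IsH2 (const S * U) := IsH2.left_mul (entriesIn_summable_const _) hU
  have hrec : ξ = (PowerSeries.X : PowerSeries ℝ) • (const B₁ - const B * U + const A * ξ) := by
    conv_lhs => rw [hξ, resolventTF_eq]
    rw [Matrix.smul_mul, Matrix.add_mul, Matrix.one_mul, Matrix.mul_assoc]
  have hξ0 : coeffMat 0 ξ = 0 := by rw [hrec, coeffMat_zero_X_smul]
  have hξ1 : coeffMat 1 ξ = B₁ := by
    rw [hrec, coeffMat_succ_X_smul, coeffMat_add, coeffMat_sub, coeffMat_const_mul,
      coeffMat_const_mul, hξ0, hU0]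
    simp
  have hξs : ∀ i, coeffMat (i + 2) ξ = A * coeffMat (i + 1) ξ - B * coeffMat (i + 1) U := by
    intro i
    conv_lhs => rw [hrec]
    rw [coeffMat_succ_X_smul, coeffMat_add, coeffMat_sub, coeffMat_const_mul,
      coeffMat_const_mul, coeffMat_const]
    simp only [Nat.add_eq_zero_iff, one_ne_zero, and_false, if_false]
    abel
  have hZi : ∀ i, coeffMat i Z = C * coeffMat i ξ - D * coeffMat i U := by
    intro i
    rw [hZξ, coeffMat_sub, coeffMat_const_mul, coeffMat_const_mul]
  set φ : ℕ → ℝ := fun i => ((coeffMat i ξ)ᵀ * P * coeffMat i ξ).trace with hφ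
  set a : ℕ → ℝ := fun i => (coeffMat i (const S * U) * (coeffMat i (const S * U))ᵀ).trace with ha
  set z : ℕ → ℝ := fun i => (coeffMat i Z * (coeffMat i Z)ᵀ).trace with hz
  have ha0 : a 0 = 0 := by simp [ha, coeffMat_const_mul, hU0]
  have hz0 : z 0 = 0 := by simp [hz, hZi, hξ0, hU0]
  have hstep : ∀ i, z (i + 1) = a (i + 1) + φ (i + 1) - φ (i + 2) := by
    intro i
    have h := congrArg Matrix.trace
      (energy_step hPs hP h0 hS (coeffMat (i + 1) ξ) (coeffMat (i + 1) U))
    rw [Matrix.trace_add, Matrix.trace_add, ← hξs, ← hZi,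
      ← coeffMat_const_mul (i + 1) S U] at h
    simp only [hz, ha, hφ]
    rw [Matrix.trace_mul_comm, Matrix.trace_mul_comm (coeffMat (i + 1) (const S * U))]
    linarith
  have hasum : Summable a := isH2_iff_summable_trace.1 hSU
  have ha_nonneg : ∀ i, 0 ≤ a i := fun i => trace_mul_transpose_self_nonneg _
  have hz_nonneg : ∀ i, 0 ≤ z i := fun i => trace_mul_transpose_self_nonneg _
  -- The balance telescopes from time `1` on, where the state equals `B₁`. Index `0` contributes
  -- nothing and has to be kept apart, since the state vanishes there.
  have hpart : ∀ n, ∑ i ∈ Finset.range n, z i =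
      ∑ i ∈ Finset.range n, a i + if n = 0 then 0 else φ 1 - φ n := by
    intro n
    induction n with
    | zero => simp
    | succ n ih =>
      rw [Finset.sum_range_succ, Finset.sum_range_succ, ih]
      rcases n with _ | n
      · simp [ha0, hz0]
      · rw [hstep]; simp; ring
  -- The terminal storage disappears because the state is in `H₂`, so its coefficients tend to zero.
  have hφlim : Filter.Tendsto φ Filter.atTop (nhds 0) := by
    have hlim : Filter.Tendsto (fun i => coeffMat i ξ) Filter.atTop (nhds 0) :=
      tendsto_pi_nhds.2 fun a => tendsto_pi_nhds.2 fun b => hξH.tendsto_zero a b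
    have hc : Continuous fun M : Matrix (Fin k) (Fin p) ℝ => (Mᵀ * P * M).trace := by fun_prop
    have h := (hc.tendsto 0).comp hlim
    rw [Matrix.transpose_zero, Matrix.zero_mul, Matrix.zero_mul, Matrix.trace_zero] at h
    exact h
  have hzsum : HasSum z (∑' i, a i + φ 1) := by
    rw [hasSum_iff_tendsto_nat_of_nonneg hz_nonneg]
    have hl : Filter.Tendsto (fun n => ∑ i ∈ Finset.range n, a i + (φ 1 - φ n)) Filter.atTop
        (nhds (∑' i, a i + (φ 1 - 0))) :=
      hasum.hasSum.tendsto_sum_nat.add (tendsto_const_nhds.sub hφlim)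
    rw [sub_zero] at hl
    refine hl.congr' ?_
    filter_upwards [Filter.eventually_gt_atTop 0] with n hn
    rw [hpart, if_neg hn.ne']
  have hφ1 : φ 1 = (B₁ᵀ * P * B₁).trace := by simp only [hφ, hξ1]
  have hPpos : 0 ≤ φ 1 := by
    rw [hφ1, ← conjTranspose_eq_transpose_of_trivial]
    exact ((hA.posSemidef_of_lyapunov hPs hP).conjTranspose_mul_mul_same B₁).trace_nonneg
  have hZH : IsH2 Z := isH2_iff_summable_trace.2 hzsum.summable
  rw [hZH.h2NormSq_eq, hSU.h2NormSq_eq, ← hφ1, ← ENNReal.ofReal_add hPpos (tsum_nonneg ha_nonneg),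
    hzsum.tsum_eq, add_comm]

end Energy

namespace Plant

variable {n p₁ p₂ q₁ q₂ : ℕ} (G : Plant n p₁ p₂ q₁ q₂) (X Y : Matrix (Fin n) (Fin n) ℝ)

/-! ### Duality -/

/-- The transposed plant. -/
def dual : Plant n q₁ q₂ p₁ p₂ where
  A := G.Aᵀ
  B₁ := G.C₁ᵀ
  B₂ := G.C₂ᵀ
  C₁ := G.B₁ᵀ
  C₂ := G.B₂ᵀ
  D₁₂ := G.D₂₁ᵀ
  D₂₁ := G.D₁₂ᵀ

variable {G X Y}

lemma _root_.DelayHTwo.IsStabilizable.dual {k m : ℕ} {A : Matrix (Fin k) (Fin k) ℝ}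
    {B : Matrix (Fin k) (Fin m) ℝ} (h : IsStabilizable A B) : IsDetectable Aᵀ Bᵀ := by
  obtain ⟨F, hF⟩ := h
  exact ⟨Fᵀ, by simpa [Matrix.transpose_mul] using hF.transpose⟩

lemma _root_.DelayHTwo.IsDetectable.dual {k m : ℕ} {A : Matrix (Fin k) (Fin k) ℝ}
    {C : Matrix (Fin m) (Fin k) ℝ} (h : IsDetectable A C) : IsStabilizable Aᵀ Cᵀ := by
  obtain ⟨H, hH⟩ := h
  exact ⟨Hᵀ, by simpa [Matrix.transpose_mul] using hH.transpose⟩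

lemma Standing.dual (hG : G.Standing) : G.dual.Standing where
  stabilizable₁ := hG.detectable₁.dual
  detectable₁ := hG.stabilizable₁.dual
  stabilizable₂ := hG.detectable₂.dual
  detectable₂ := hG.stabilizable₂.dual
  D₁₂_C₁ := hG.D₂₁_B₁
  D₁₂_D₁₂ := hG.D₂₁_D₂₁
  D₂₁_B₁ := hG.D₁₂_C₁
  D₂₁_D₂₁ := hG.D₁₂_D₁₂

lemma dual_Ω : G.dual.Ω Y = G.Ψ Y := rfl

lemma Ψ_transpose (hY : Yᵀ = Y) : (G.Ψ Y)ᵀ = G.Ψ Y := by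
  simp [Ψ, Matrix.transpose_mul, hY, Matrix.mul_assoc]

lemma Ω_transpose (hX : Xᵀ = X) : (G.Ω X)ᵀ = G.Ω X := by
  simp [Ω, Matrix.transpose_mul, hX, Matrix.mul_assoc]

lemma dual_gainK (hY : Yᵀ = Y) : G.dual.gainK Y = (G.gainL Y)ᵀ := by
  simp only [gainK, gainL, dual_Ω, Matrix.transpose_neg, Matrix.transpose_mul,
    Matrix.transpose_nonsing_inv, Ψ_transpose hY, hY, Matrix.mul_assoc]
  rfl

lemma dual_AK (hY : Yᵀ = Y) : G.dual.AK Y = (G.AL Y)ᵀ := by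
  simp only [AK, AL, dual_gainK hY, Matrix.transpose_add, Matrix.transpose_mul]
  rfl

lemma IsFilterRiccati.dual (hY : G.IsFilterRiccati Y) : G.dual.IsControlRiccati Y where
  symm := hY.symm
  eq := hY.eq
  stable := by
    have := hY.stable.transpose
    change IsStableMatrix (G.dual.AK Y)
    rw [dual_AK hY.symm]
    exact this

/-! ### Consequences of the Riccati equations -/

namespace IsControlRiccati

/-- Completing the square at the feedback `u = K x` turns the Riccati equation into a Lyapunov
equation for the closed-loop matrix. Positivity of `X` is deduced from it. -/
lemma lyapunov (hX : G.IsControlRiccati X) (hG : G.Standing) :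
    X = (G.AK X)ᵀ * X * G.AK X +
      (G.C₁ + G.D₁₂ * G.gainK X)ᵀ * (G.C₁ + G.D₁₂ * G.gainK X) := by
  have hD : G.C₁ᵀ * G.D₁₂ = 0 := by
    simpa [Matrix.transpose_mul] using congrArg Matrix.transpose hG.D₁₂_C₁
  -- Invertibility of `Ω` is not available yet, as it follows from `X ≥ 0` and hence from this
  -- lemma. The identity still holds for singular `Ω`, whose inverse is `0` by convention.
  have hΩ : (G.Ω X)⁻¹ * G.Ω X * (G.Ω X)⁻¹ = (G.Ω X)⁻¹ := by
    by_cases h : IsUnit (G.Ω X).det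
    · rw [Matrix.nonsing_inv_mul _ h, Matrix.one_mul]
    · rw [Matrix.nonsing_inv_apply_not_isUnit _ h, Matrix.mul_zero]
  set K := G.gainK X with hK
  set W := (G.Ω X)⁻¹ with hW
  have hWt : Wᵀ = W := by rw [hW, Matrix.transpose_nonsing_inv, Ω_transpose hX.symm]
  set T := G.B₂ᵀ * X * G.A with hT
  have hKT : K = -(W * T) := by rw [hK, gainK, hT]; simp only [Matrix.mul_assoc]; rfl
  have hTt : Tᵀ = G.Aᵀ * X * G.B₂ := by
    rw [hT]; simp [Matrix.transpose_mul, hX.symm, Matrix.mul_assoc]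
  have h1 : (G.C₁ + G.D₁₂ * K)ᵀ * (G.C₁ + G.D₁₂ * K) = G.C₁ᵀ * G.C₁ + Kᵀ * K := by
    calc _ = G.C₁ᵀ * G.C₁ + (G.C₁ᵀ * G.D₁₂) * K + Kᵀ * (G.D₁₂ᵀ * G.C₁) +
          Kᵀ * (G.D₁₂ᵀ * G.D₁₂) * K := by
          simp only [Matrix.transpose_add, Matrix.transpose_mul, Matrix.mul_add, Matrix.add_mul,
            Matrix.mul_assoc]
          abel
      _ = _ := by rw [hD, hG.D₁₂_C₁, hG.D₁₂_D₁₂]; simp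
  have h2 : (G.AK X)ᵀ * X * G.AK X + Kᵀ * K =
      G.Aᵀ * X * G.A + Tᵀ * K + Kᵀ * T + Kᵀ * G.Ω X * K := by
    rw [AK, ← hK, hTt, hT, Ω]
    simp only [Matrix.transpose_add, Matrix.transpose_mul, Matrix.mul_add, Matrix.add_mul,
      Matrix.mul_assoc, Matrix.mul_one]
    abel
  have h3 : Tᵀ * K + Kᵀ * T + Kᵀ * G.Ω X * K = -(Tᵀ * W * T) := by
    have hKt : Kᵀ = -(Tᵀ * W) := by
      rw [hKT, Matrix.transpose_neg, Matrix.transpose_mul W T, hWt]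
    have h4 : Kᵀ * G.Ω X * K = Tᵀ * (W * G.Ω X * W) * T := by
      rw [hKt, hKT]
      simp only [Matrix.neg_mul, Matrix.mul_neg, neg_neg, Matrix.mul_assoc]
    rw [h4, hΩ, hKt, hKT]
    simp only [Matrix.neg_mul, Matrix.mul_neg, Matrix.mul_assoc]
    abel
  have h5 := hX.eq
  rw [h1]
  calc X = G.C₁ᵀ * G.C₁ + G.Aᵀ * X * G.A - Tᵀ * W * T := by
        rw [hTt, hT]
        simp only [Matrix.mul_assoc] at h5 ⊢
        exact h5
    _ = G.C₁ᵀ * G.C₁ + ((G.AK X)ᵀ * X * G.AK X + Kᵀ * K) := by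
        rw [h2, sub_eq_add_neg, ← h3]; abel
    _ = _ := by abel

lemma stable_AK (hX : G.IsControlRiccati X) : IsStableMatrix (G.AK X) := hX.stable

lemma posSemidef (hX : G.IsControlRiccati X) (hG : G.Standing) : X.PosSemidef :=
  hX.stable_AK.posSemidef_of_lyapunov hX.symm (hX.lyapunov hG)

lemma posDef_Ω (hX : G.IsControlRiccati X) (hG : G.Standing) : (G.Ω X).PosDef := by
  refine Matrix.PosDef.add_posSemidef Matrix.PosDef.one ?_
  have := (hX.posSemidef hG).conjTranspose_mul_mul_same G.B₂
  rwa [conjTranspose_eq_transpose_of_trivial] at this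

/-- This is the stationarity condition `Ω K = -B₂ᵀ X A` defining the gain. It removes the cross
terms in the energy balance. -/
lemma orthogonality (hX : G.IsControlRiccati X) (hG : G.Standing) :
    G.D₁₂ᵀ * (G.C₁ + G.D₁₂ * G.gainK X) + G.B₂ᵀ * X * G.AK X = 0 := by
  have hu : IsUnit (G.Ω X).det := (hX.posDef_Ω hG).det_pos.ne'.isUnit
  have h1 : G.Ω X * G.gainK X = -(G.B₂ᵀ * X * G.A) := by
    rw [gainK, Matrix.mul_neg]
    simp only [Matrix.mul_assoc]
    rw [Matrix.mul_nonsing_inv_cancel_left _ _ hu]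
  have h2 : G.D₁₂ᵀ * (G.C₁ + G.D₁₂ * G.gainK X) + G.B₂ᵀ * X * G.AK X =
      G.Ω X * G.gainK X + G.B₂ᵀ * X * G.A := by
    rw [Matrix.mul_add, hG.D₁₂_C₁, ← Matrix.mul_assoc, hG.D₁₂_D₁₂, AK, Ω]
    simp only [Matrix.mul_add, Matrix.add_mul, Matrix.mul_assoc]
    abel
  rw [h2, h1, neg_add_cancel]

end IsControlRiccati

lemma IsFilterRiccati.stable_AL (hY : G.IsFilterRiccati Y) : IsStableMatrix (G.AL Y) := hY.stable

lemma IsFilterRiccati.posDef_Ψ (hY : G.IsFilterRiccati Y) (hG : G.Standing) :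
    (G.Ψ Y).PosDef := hY.dual.posDef_Ω hG.dual

end Plant

/-! ### Square roots of positive semidefinite matrices -/

section SqrtMat

variable {ι : Type} [Fintype ι] [DecidableEq ι] {A : Matrix ι ι ℝ}

open scoped MatrixOrder in
lemma sqrtMat_mul_self (hA : A.PosSemidef) : sqrtMat A * sqrtMat A = A :=
  CFC.sqrt_mul_sqrt_self A (ha := hA.nonneg)

open scoped MatrixOrder in
lemma sqrtMat_transpose (A : Matrix ι ι ℝ) : (sqrtMat A)ᵀ = sqrtMat A := by
  have h : (sqrtMat A).PosSemidef := Matrix.nonneg_iff_posSemidef.1 (CFC.sqrt_nonneg A)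
  rw [← conjTranspose_eq_transpose_of_trivial]
  exact h.isHermitian

end SqrtMat

namespace Plant

variable {n p₁ p₂ q₁ q₂ : ℕ} (G : Plant n p₁ p₂ q₁ q₂) (X Y : Matrix (Fin n) (Fin n) ℝ)

/-! ### The model matching form of the closed loop -/

/-- `N₁₂ = G₁₂ M̂`. -/
def N₁₂ : TF q₁ p₂ := realization (G.AK X) G.B₂ (G.C₁ + G.D₁₂ * G.gainK X) G.D₁₂

/-- `N₂₁ = M̃ G₂₁`. -/
def N₂₁ : TF q₂ p₁ := realization (G.AL Y) (G.B₁ + G.gainL Y * G.D₂₁) G.C₂ G.D₂₁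

/-- `Ñ = M̃ G₂₂`. -/
def Ntilde : TF q₂ p₂ := realization (G.AL Y) G.B₂ G.C₂ 0

/-- The state-feedback part of `P₁₁`. -/
def regulatorTF : TF q₁ p₁ := realization (G.AK X) G.B₁ (G.C₁ + G.D₁₂ * G.gainK X) 0

/-- The estimation part of `P₁₁`. -/
def estimatorTF : TF p₂ p₁ :=
  realization (G.AL Y) (G.B₁ + G.gainL Y * G.D₂₁) (G.gainK X) 0

section ResolventIdentities

variable {G X Y}

/-- The resolvent identity for `A` and `A + B₂ K`. This and its four variants below carry a trailing
factor `W` and are fully right-associated, so that they act as rewrite rules inside longer products.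
-/
lemma resolvent_A_K {j : ℕ} (W : TF n j) :
    resolventTF G.A * (const G.B₂ * (const (G.gainK X) * (resolventTF (G.AK X) * W))) =
      resolventTF (G.AK X) * W - resolventTF G.A * W := by
  have h := congrArg (· * W) (resolventTF_sub G.A (G.AK X))
  have e : G.AK X - G.A = G.B₂ * G.gainK X := by rw [AK]; abel
  simp only [e, const_mul, Matrix.sub_mul, Matrix.mul_assoc] at h
  exact h.symm

lemma resolvent_A_L {j : ℕ} (W : TF n j) :
    resolventTF G.A * (const (G.gainL Y) * (const G.C₂ * (resolventTF (G.AL Y) * W))) =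
      resolventTF (G.AL Y) * W - resolventTF G.A * W := by
  have h := congrArg (· * W) (resolventTF_sub G.A (G.AL Y))
  have e : G.AL Y - G.A = G.gainL Y * G.C₂ := by rw [AL]; abel
  simp only [e, const_mul, Matrix.sub_mul, Matrix.mul_assoc] at h
  exact h.symm

lemma resolvent_L_A {j : ℕ} (W : TF n j) :
    resolventTF (G.AL Y) * (const (G.gainL Y) * (const G.C₂ * (resolventTF G.A * W))) =
      resolventTF (G.AL Y) * W - resolventTF G.A * W := by
  have h := congrArg (fun M => -(M * W)) (resolventTF_sub (G.AL Y) G.A)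
  have e : G.A - G.AL Y = -(G.gainL Y * G.C₂) := by rw [AL]; abel
  simp only [e, const_neg, const_mul, Matrix.sub_mul, Matrix.mul_assoc, Matrix.neg_mul,
    Matrix.mul_neg, neg_sub, neg_neg] at h
  exact h.symm

lemma resolvent_L_K {j : ℕ} (W : TF n j) :
    resolventTF (G.AL Y) * (const (G.gainL Y) * (const G.C₂ * (resolventTF (G.AK X) * W))) =
      resolventTF (G.AL Y) * W - resolventTF (G.AK X) * W +
        resolventTF (G.AL Y) * (const G.B₂ * (const (G.gainK X) * (resolventTF (G.AK X) * W))) := by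
  have h := congrArg (· * W) (resolventTF_sub (G.AL Y) (G.AK X))
  have e : G.AK X - G.AL Y = G.B₂ * G.gainK X - G.gainL Y * G.C₂ := by rw [AL, AK]; abel
  simp only [e, const_sub, const_mul, Matrix.sub_mul, Matrix.mul_sub, Matrix.mul_assoc] at h
  rw [eq_sub_iff_add_eq] at h
  rw [← h]; abel

lemma resolvent_K_L {j : ℕ} (W : TF n j) :
    resolventTF (G.AK X) * (const (G.gainL Y) * (const G.C₂ * (resolventTF (G.AL Y) * W))) =
      resolventTF (G.AL Y) * W - resolventTF (G.AK X) * W +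
        resolventTF (G.AK X) * (const G.B₂ * (const (G.gainK X) * (resolventTF (G.AL Y) * W))) := by
  have h := congrArg (· * W) (resolventTF_sub (G.AK X) (G.AL Y))
  have e : G.AL Y - G.AK X = G.gainL Y * G.C₂ - G.B₂ * G.gainK X := by rw [AL, AK]; abel
  simp only [e, const_sub, const_mul, Matrix.sub_mul, Matrix.mul_sub, Matrix.mul_assoc] at h
  rw [h]; abel

end ResolventIdentities

/-! ### Coprime factor identities and the Bezout identity -/

lemma G₁₂_mul_Mhat : G.G₁₂ * G.Mhat X = G.N₁₂ X := by
  simp only [G₁₂, Mhat, N₁₂, realization_eq, const_add, const_mul, const_one, Matrix.mul_add,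
    Matrix.add_mul, Matrix.mul_one, Matrix.mul_assoc, resolvent_A_K, Matrix.mul_sub]
  abel

lemma G₂₂_mul_Mhat : G.G₂₂ * G.Mhat X = G.Nhat X := by
  simp only [G₂₂, Mhat, Nhat, realization_eq, const_zero, const_one, Matrix.mul_add,
    add_zero, Matrix.mul_one, Matrix.mul_assoc, resolvent_A_K, Matrix.mul_sub]
  abel

lemma Mtilde_mul_G₂₁ : G.Mtilde Y * G.G₂₁ = G.N₂₁ Y := by
  simp only [G₂₁, Mtilde, N₂₁, realization_eq, const_add, const_mul, const_neg, const_one,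
    Matrix.mul_add, Matrix.add_mul, Matrix.one_mul, Matrix.mul_assoc, resolvent_L_A,
    Matrix.mul_sub, Matrix.neg_mul, Matrix.mul_neg, neg_neg]
  abel

lemma Mtilde_mul_G₂₂ : G.Mtilde Y * G.G₂₂ = G.Ntilde Y := by
  simp only [G₂₂, Mtilde, Ntilde, realization_eq, const_zero, const_neg, const_one,
    add_zero, Matrix.add_mul, Matrix.one_mul, Matrix.mul_assoc, resolvent_L_A,
    Matrix.mul_sub, Matrix.neg_mul, Matrix.mul_neg, neg_neg]
  abel

lemma bezout : G.Mtilde Y * G.Xhat X Y - G.Ntilde Y * G.Yhat X Y = 1 := by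
  simp only [Mtilde, Xhat, Ntilde, Yhat, realization_eq, const_zero, const_neg, const_one,
    add_zero, Matrix.add_mul, Matrix.one_mul, Matrix.mul_one, Matrix.mul_assoc, resolvent_L_K,
    Matrix.mul_add, Matrix.mul_sub, Matrix.neg_mul, Matrix.mul_neg, neg_neg]
  abel

/-- The separation principle: the central closed loop is the full-information regulator, corrected
by the response of `N₁₂` to the error in estimating `K x`. A parameter `V` adds `V N₂₁` to that
error signal. -/
lemma P₁₁_eq : G.P₁₁ X Y = G.regulatorTF X - G.N₁₂ X * G.estimatorTF X Y := by
  rw [P₁₁, Matrix.mul_assoc _ (G.Mtilde Y), Mtilde_mul_G₂₁]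
  simp only [G₁₁, G₁₂, Yhat, N₂₁, regulatorTF, N₁₂, estimatorTF, realization_eq, const_zero,
    const_neg, const_add, const_mul, add_zero, Matrix.add_mul, Matrix.mul_assoc, resolvent_A_K,
    resolvent_A_L, resolvent_K_L, Matrix.mul_add, Matrix.mul_sub, Matrix.sub_mul, Matrix.neg_mul,
    Matrix.mul_neg]
  abel

variable {G X Y}

/-! ### The cost of a Youla parameter -/

lemma qpCost_eq (V : TF p₂ q₂) :
    G.qpCost X Y V = h2NormSq (const (sqrtMat (G.Ω X)) * V * const (sqrtMat (G.Ψ Y))) := rfl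

lemma N₂₁_transpose (hY : Yᵀ = Y) : (G.N₂₁ Y)ᵀ = G.dual.N₁₂ Y := by
  rw [N₂₁, N₁₂, realization_transpose, dual_AK hY, dual_gainK hY, Matrix.transpose_add,
    Matrix.transpose_mul]
  rfl

lemma h2NormSq_regulator_sub (hG : G.Standing) (hX : G.IsControlRiccati X) {j : ℕ}
    (B : Matrix (Fin n) (Fin j) ℝ) {U : TF p₂ j} (hU : IsH2 U) (hU0 : coeffMat 0 U = 0) :
    h2NormSq (realization (G.AK X) B (G.C₁ + G.D₁₂ * G.gainK X) 0 - G.N₁₂ X * U) =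
      ENNReal.ofReal (Bᵀ * X * B).trace + h2NormSq (const (sqrtMat (G.Ω X)) * U) := by
  refine h2NormSq_sub_realization_mul hX.stable_AK hX.symm (hX.lyapunov hG)
    (hX.orthogonality hG) ?_ B hU hU0
  rw [sqrtMat_transpose, sqrtMat_mul_self (hX.posDef_Ω hG).posSemidef, hG.D₁₂_D₁₂, Ω]

lemma estimatorTF_summable (hY : G.IsFilterRiccati Y) :
    EntriesIn summableSubring (G.estimatorTF X Y) := hY.stable_AL.summable_realization _ _ _

lemma N₂₁_summable (hY : G.IsFilterRiccati Y) :
    EntriesIn summableSubring (G.N₂₁ Y) := hY.stable_AL.summable_realization _ _ _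

lemma N₁₂_summable (hX : G.IsControlRiccati X) :
    EntriesIn summableSubring (G.N₁₂ X) := hX.stable_AK.summable_realization _ _ _

lemma isH2_P₁₁ (hX : G.IsControlRiccati X) (hY : G.IsFilterRiccati Y) :
    IsH2 (G.P₁₁ X Y) := by
  rw [P₁₁_eq]
  exact IsH2.of_summable ((hX.stable_AK.summable_realization _ _ _).sub
    ((N₁₂_summable hX).mul (estimatorTF_summable hY)))

/-- Transposition preserves the norm and turns the estimation problem into the regulator problem of
the dual plant, whose storage matrix is `Y`, weight is `Ψ`, and initial state is `(Ω^{1/2} K)ᵀ`. -/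
lemma h2NormSq_estimator_add (hG : G.Standing)
    (hY : G.IsFilterRiccati Y) {V : TF p₂ q₂} (hV : IsH2 V) (hV0 : coeffMat 0 V = 0) :
    h2NormSq (const (sqrtMat (G.Ω X)) * (G.estimatorTF X Y + V * G.N₂₁ Y)) =
      ENNReal.ofReal (sqrtMat (G.Ω X) * G.gainK X * Y * (sqrtMat (G.Ω X) * G.gainK X)ᵀ).trace +
        G.qpCost X Y V := by
  have hU : IsH2 (-(const (sqrtMat (G.Ω X)) * V)ᵀ) :=
    (IsH2.left_mul (entriesIn_summable_const _) hV).transpose.neg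
  have hU0 : coeffMat 0 (-(const (sqrtMat (G.Ω X)) * V)ᵀ) = 0 := by
    rw [coeffMat_neg, coeffMat_transpose, coeffMat_const_mul, hV0]; simp
  have h := h2NormSq_regulator_sub hG.dual hY.dual (sqrtMat (G.Ω X) * G.gainK X)ᵀ hU hU0
  rw [Matrix.transpose_transpose] at h
  rw [← h2NormSq_transpose]
  convert h using 2
  · rw [← N₂₁_transpose hY.symm, Matrix.mul_neg, sub_neg_eq_add, Matrix.mul_add,
      Matrix.transpose_add, ← Matrix.transpose_mul, ← Matrix.mul_assoc]
    congr 1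
    rw [dual_AK hY.symm, dual_gainK hY.symm, estimatorTF]
    simp only [realization_eq, const_zero, add_zero, Matrix.transpose_mul, const_transpose,
      resolventTF_transpose, const_mul, Matrix.mul_assoc, Matrix.transpose_add]
    rfl
  · rw [dual_Ω, Matrix.mul_neg, ← h2NormSq_transpose, qpCost_eq]
    unfold h2NormSq
    congr 1
    ext i
    rw [Matrix.transpose_neg, coeffMat_neg, Matrix.neg_mul, Matrix.transpose_neg, Matrix.mul_neg,
      neg_neg, Matrix.transpose_mul, Matrix.transpose_transpose, const_transpose,
      sqrtMat_transpose]

/-- The cost of the closed loop with Youla parameter `V`. -/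
theorem h2NormSq_P₁₁_sub (hG : G.Standing) (hX : G.IsControlRiccati X)
    (hY : G.IsFilterRiccati Y) {V : TF p₂ q₂} (hV : IsH2 V) (hV0 : coeffMat 0 V = 0) :
    h2NormSq (G.P₁₁ X Y - G.N₁₂ X * V * G.N₂₁ Y) =
      h2NormSq (G.P₁₁ X Y) + G.qpCost X Y V := by
  have key : ∀ V : TF p₂ q₂, IsH2 V → coeffMat 0 V = 0 →
      h2NormSq (G.P₁₁ X Y - G.N₁₂ X * V * G.N₂₁ Y) =
      ENNReal.ofReal (G.B₁ᵀ * X * G.B₁).trace +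
      (ENNReal.ofReal (sqrtMat (G.Ω X) * G.gainK X * Y * (sqrtMat (G.Ω X) * G.gainK X)ᵀ).trace +
        G.qpCost X Y V) := by
    intro V hV hV0
    have hU : IsH2 (G.estimatorTF X Y + V * G.N₂₁ Y) :=
      (IsH2.of_summable (estimatorTF_summable hY)).add (hV.right_mul (N₂₁_summable hY))
    have hU0 : coeffMat 0 (G.estimatorTF X Y + V * G.N₂₁ Y) = 0 := by
      simp [coeffMat_add, coeffMat_zero_mul, hV0, estimatorTF]
    rw [← h2NormSq_estimator_add hG hY hV hV0, ← h2NormSq_regulator_sub hG hX _ hU hU0,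
      P₁₁_eq, Matrix.mul_add, Matrix.mul_assoc, regulatorTF, sub_sub]
  -- The case `V = 0` identifies the two constant trace terms with `‖P₁₁‖²`.
  have h0 := key 0 (fun _ _ => squareSummable.zero_mem) (coeffMat_zero 0)
  have hq0 : G.qpCost X Y 0 = 0 := by simp [qpCost_eq, h2NormSq]
  rw [Matrix.mul_zero, Matrix.zero_mul, sub_zero, hq0, add_zero] at h0
  rw [key V hV hV0, h0, add_assoc]

/-! ### Recovering the Youla parameter from the closed loop -/

/-- Since `B' C = A - A'`, the product of the two resolvents collapses by the resolvent identity,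
and the remaining terms cancel in pairs up to `D' D = 1`. -/
lemma _root_.DelayHTwo.realization_mul_realization_eq_one {m r : ℕ}
    {A A' : Matrix (Fin n) (Fin n) ℝ} {B : Matrix (Fin n) (Fin r) ℝ} {C : Matrix (Fin m) (Fin n) ℝ}
    {D : Matrix (Fin m) (Fin r) ℝ} {B' : Matrix (Fin n) (Fin m) ℝ} {K : Matrix (Fin r) (Fin n) ℝ}
    {D' : Matrix (Fin r) (Fin m) ℝ} (h1 : B' * C = A - A') (h2 : B' * D = B) (h3 : D' * C = K)
    (h4 : D' * D = 1) : realization A' B' (-K) D' * realization A B C D = 1 := by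
  have hr := resolventTF_sub A' A
  rw [← h1] at hr
  calc realization A' B' (-K) D' * realization A B C D
      = -(const K * (resolventTF A' * const (B' * C) * resolventTF A) * const B) -
        const K * resolventTF A' * const (B' * D) + const (D' * C) * resolventTF A * const B +
        const (D' * D) := by
        simp only [realization_eq, const_mul, const_neg, Matrix.mul_add, Matrix.add_mul,
          Matrix.mul_assoc, Matrix.neg_mul]
        abel
    _ = 1 := by
        rw [← hr, h2, h3, h4, const_one]
        simp only [Matrix.mul_sub, Matrix.sub_mul, Matrix.mul_assoc]
        abel

lemma exists_N₁₂_left_inverse (hG : G.Standing) :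
    ∃ M : TF p₂ q₁, EntriesIn summableSubring M ∧ M * G.N₁₂ X = 1 := by
  obtain ⟨H, hH⟩ := hG.detectable₁
  -- Left multiplication by `D₁₂ᵀ` recovers the input, as `D₁₂ᵀ C₁ = 0`. The projection `1 - D₁₂
  -- D₁₂ᵀ` extracts `C₁` from `C₁ + D₁₂ K` and annihilates `D₁₂`, so injecting it through `-H`
  -- produces the stable matrix `A + H C₁`.
  refine ⟨realization (G.A + H * G.C₁) (G.B₂ * G.D₁₂ᵀ - H * (1 - G.D₁₂ * G.D₁₂ᵀ))
    (-G.gainK X) G.D₁₂ᵀ, hH.summable_realization _ _ _, ?_⟩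
  set K := G.gainK X with hK
  have h1 : (G.B₂ * G.D₁₂ᵀ - H * (1 - G.D₁₂ * G.D₁₂ᵀ)) * (G.C₁ + G.D₁₂ * K) =
      G.AK X - (G.A + H * G.C₁) := by
    calc _ = G.B₂ * (G.D₁₂ᵀ * G.C₁) + G.B₂ * (G.D₁₂ᵀ * G.D₁₂) * K - H * G.C₁ - H * G.D₁₂ * K
          + H * G.D₁₂ * (G.D₁₂ᵀ * G.C₁) + H * G.D₁₂ * (G.D₁₂ᵀ * G.D₁₂) * K := by
          simp only [Matrix.mul_add, Matrix.mul_sub, Matrix.sub_mul, Matrix.mul_assoc,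
            Matrix.one_mul]
          abel
      _ = _ := by
          rw [hG.D₁₂_C₁, hG.D₁₂_D₁₂, AK]
          simp only [Matrix.mul_zero, Matrix.mul_one]
          abel
  have h2 : (G.B₂ * G.D₁₂ᵀ - H * (1 - G.D₁₂ * G.D₁₂ᵀ)) * G.D₁₂ = G.B₂ := by
    calc _ = G.B₂ * (G.D₁₂ᵀ * G.D₁₂) - H * G.D₁₂ + H * G.D₁₂ * (G.D₁₂ᵀ * G.D₁₂) := by
          simp only [Matrix.mul_sub, Matrix.sub_mul, Matrix.mul_assoc, Matrix.one_mul]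
          abel
      _ = _ := by rw [hG.D₁₂_D₁₂]; simp
  have h3 : G.D₁₂ᵀ * (G.C₁ + G.D₁₂ * K) = K := by
    rw [Matrix.mul_add, hG.D₁₂_C₁, ← Matrix.mul_assoc, hG.D₁₂_D₁₂]; simp
  exact realization_mul_realization_eq_one h1 h2 h3 hG.D₁₂_D₁₂

/-- Multiplying by absolutely summable inverses on both sides recovers `V` without leaving `H₂`. The
right inverse of `N₂₁` is the transposed left inverse of the dual plant. -/
lemma isH2_of_isH2_P₁₁_sub (hG : G.Standing) (hX : G.IsControlRiccati X)
    (hY : G.IsFilterRiccati Y) {V : TF p₂ q₂}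
    (h : IsH2 (G.P₁₁ X Y - G.N₁₂ X * V * G.N₂₁ Y)) : IsH2 V := by
  obtain ⟨M, hM, hM1⟩ := exists_N₁₂_left_inverse (X := X) hG
  obtain ⟨M', hM', hM1'⟩ := exists_N₁₂_left_inverse (X := Y) hG.dual
  have h1 : G.N₂₁ Y * M'ᵀ = 1 := by
    rw [← Matrix.transpose_transpose (G.N₂₁ Y), N₂₁_transpose hY.symm, ← Matrix.transpose_mul,
      hM1', Matrix.transpose_one]
  have h2 : IsH2 (G.N₁₂ X * V * G.N₂₁ Y) := by
    have := (isH2_P₁₁ hX hY).sub h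
    rwa [sub_sub_cancel] at this
  have h3 : M * (G.N₁₂ X * V * G.N₂₁ Y) * M'ᵀ = V := by
    calc _ = (M * G.N₁₂ X) * V * (G.N₂₁ Y * M'ᵀ) := by simp only [Matrix.mul_assoc]
      _ = V := by rw [hM1, h1]; simp
  rw [← h3]
  exact (IsH2.left_mul hM h2).right_mul hM'.transpose

end Plant

/-! ### The delay space and quadratic invariance -/

section DelaySpace

variable {N p q : ℕ} {𝒴 : ℕ → Submodule ℝ (Matrix (Fin p) (Fin q) ℝ)}

lemma exists_eq_X_pow_smul {m n : ℕ} {F : TF m n} {k : ℕ} (h : ∀ i, i < k → coeffMat i F = 0) :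
    ∃ F' : TF m n, F = (PowerSeries.X : PowerSeries ℝ) ^ k • F' := by
  refine ⟨ofCoeffs fun i => coeffMat (i + k) F, TF.ext_coeffMat fun i => ?_⟩
  rcases lt_or_ge i k with hi | hi
  · rw [h i hi, coeffMat_X_pow_smul_of_lt hi]
  · obtain ⟨j, rfl⟩ := Nat.exists_eq_add_of_le' hi
    ext a b
    simp [PowerSeries.coeff_X_pow_mul, ofCoeffs]

/-- The low coefficients of the numerator vanish, so the power of `1/z` divides it and can be
cancelled. This keeps the tail of a rational series rational. -/
lemma mem_properRing_of_X_pow_mul {f : PowerSeries ℝ} {k : ℕ}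
    (h : (PowerSeries.X : PowerSeries ℝ) ^ k * f ∈ fractionSubring properDenominators) :
    f ∈ fractionSubring properDenominators := by
  obtain ⟨r, d, hd, e⟩ := h
  have hdvd : (Polynomial.X : Polynomial ℝ) ^ k ∣ r := by
    rw [Polynomial.X_pow_dvd_iff]
    intro i hi
    rw [← Polynomial.coeff_coe, ← e, mul_left_comm, PowerSeries.coeff_X_pow_mul', if_neg hi.not_ge]
  obtain ⟨r', rfl⟩ := hdvd
  refine ⟨r', d, hd, ?_⟩
  push_cast at e
  rw [mul_left_comm] at e
  exact mul_left_cancel₀ (pow_ne_zero _ PowerSeries.X_ne_zero) e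

lemma mem_delaySpace_iff {K : TF p q} :
    K ∈ delaySpace N 𝒴 ↔ EntriesIn (fractionSubring properDenominators) K ∧ coeffMat 0 K = 0 ∧
      ∀ i, 1 ≤ i → i ≤ N → coeffMat i K ∈ 𝒴 i := by
  constructor
  · rintro ⟨V, ⟨hV, hV𝒴⟩, W, hW, rfl⟩
    refine ⟨?_, ?_, fun i hi hiN => ?_⟩
    · refine (entriesIn_of_coeffMat_eq_zero _ (N := N) fun i hi => hV i (by omega)).add
        (EntriesIn.smul (Subring.pow_mem _ (X_mem_fractionSubring _) _) hW)
    · rw [coeffMat_add, coeffMat_X_pow_smul_of_lt (by omega), hV 0 (by omega), add_zero]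
    · rw [coeffMat_add, coeffMat_X_pow_smul_of_lt (by omega), add_zero]
      exact hV𝒴 i hi hiN
  · rintro ⟨hK, hK0, hK𝒴⟩
    have hco : ∀ i, coeffMat i (projFIR N K) = if 1 ≤ i ∧ i ≤ N then coeffMat i K else 0 :=
      fun i => coeffMat_ofCoeffs _ _
    have hFIR : projFIR N K ∈ strictFIR p q N := fun i hi => by rw [hco, if_neg hi]
    obtain ⟨W, hW⟩ := exists_eq_X_pow_smul (F := K - projFIR N K) (k := N + 1) fun i hi => by
      rw [coeffMat_sub, hco]
      rcases i with _ | i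
      · simp [hK0]
      · rw [if_pos (by omega), sub_self]
    refine ⟨projFIR N K, ⟨hFIR, fun i hi hiN => ?_⟩, W, fun a b => ?_, ?_⟩
    · rw [hco, if_pos ⟨hi, hiN⟩]; exact hK𝒴 i hi hiN
    · refine mem_properRing_of_X_pow_mul (k := N + 1) ?_
      have := (hK.sub (entriesIn_of_coeffMat_eq_zero _ (N := N) fun i hi =>
        hFIR i (by omega))) a b
      rw [hW] at this
      exact this
    · rw [← hW]; abel

lemma add_mem_delaySpace {K₁ K₂ : TF p q} (h₁ : K₁ ∈ delaySpace N 𝒴)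
    (h₂ : K₂ ∈ delaySpace N 𝒴) : K₁ + K₂ ∈ delaySpace N 𝒴 := by
  rw [mem_delaySpace_iff] at *
  refine ⟨h₁.1.add h₂.1, by rw [coeffMat_add, h₁.2.1, h₂.2.1, add_zero], fun i hi hiN => ?_⟩
  rw [coeffMat_add]
  exact (𝒴 i).add_mem (h₁.2.2 i hi hiN) (h₂.2.2 i hi hiN)

lemma const_smul_mem_delaySpace {K : TF p q} (h : K ∈ delaySpace N 𝒴) (c : ℝ) :
    PowerSeries.C c • K ∈ delaySpace N 𝒴 := by
  have hc : ∀ i, coeffMat i (PowerSeries.C c • K) = c • coeffMat i K := by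
    intro i; ext; simp
  rw [mem_delaySpace_iff] at *
  refine ⟨EntriesIn.smul ?_ h.1, by rw [hc, h.2.1, smul_zero], fun i hi hiN => ?_⟩
  · simpa using coe_mem_fractionSubring properDenominators (Polynomial.C c)
  · rw [hc]; exact (𝒴 i).smul_mem _ (h.2.2 i hi hiN)

lemma neg_mem_delaySpace {K : TF p q} (h : K ∈ delaySpace N 𝒴) : -K ∈ delaySpace N 𝒴 := by
  have := const_smul_mem_delaySpace h (-1)
  simpa using this

namespace QuadraticallyInvariant

variable {G : TF q p}

lemma neg (hQI : QuadraticallyInvariant (delaySpace N 𝒴) G) :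
    QuadraticallyInvariant (delaySpace N 𝒴) (-G) := fun K hK => by
  rw [Matrix.mul_neg, Matrix.neg_mul]
  exact neg_mem_delaySpace (hQI K hK)

/-- Quadratic invariance is applied to `K₁ + K₂`, `K₁` and `K₂`. -/
lemma polarization (hQI : QuadraticallyInvariant (delaySpace N 𝒴) G) {K₁ K₂ : TF p q}
    (h₁ : K₁ ∈ delaySpace N 𝒴) (h₂ : K₂ ∈ delaySpace N 𝒴) :
    K₁ * G * K₂ + K₂ * G * K₁ ∈ delaySpace N 𝒴 := by
  have h := add_mem_delaySpace (hQI _ (add_mem_delaySpace h₁ h₂))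
    (neg_mem_delaySpace (add_mem_delaySpace (hQI _ h₁) (hQI _ h₂)))
  convert h using 1
  simp only [Matrix.add_mul, Matrix.mul_add]
  abel

/-- In the polarization of `K` and `K (G K)ʲ` both cross terms equal `K (G K)ʲ⁺¹`, so half of their
sum is the next power. -/
lemma mul_pow_mem (hQI : QuadraticallyInvariant (delaySpace N 𝒴) G) {K : TF p q}
    (hK : K ∈ delaySpace N 𝒴) (j : ℕ) : K * (G * K) ^ j ∈ delaySpace N 𝒴 := by
  induction j with
  | zero => simpa using hK
  | succ j ih =>
    have h := const_smul_mem_delaySpace (hQI.polarization hK ih) 2⁻¹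
    have h1 : K * G * (K * (G * K) ^ j) = K * (G * K) ^ (j + 1) := by
      rw [pow_succ']; simp only [Matrix.mul_assoc]
    have h2 : K * (G * K) ^ j * G * K = K * (G * K) ^ (j + 1) := by
      rw [pow_succ]; simp only [Matrix.mul_assoc]
    rw [h1, h2, ← two_smul (PowerSeries ℝ), smul_smul] at h
    have h3 : (PowerSeries.C (2⁻¹ : ℝ)) * 2 = 1 := by
      rw [← map_ofNat (PowerSeries.C (R := ℝ)) 2, ← map_mul]; norm_num
    rwa [h3, one_smul] at h

/-- Quadratic invariance: `K (I - G K)⁻¹` stays in the constraint space. -/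
theorem feedback_mem (hQI : QuadraticallyInvariant (delaySpace N 𝒴) G)
    (hG : EntriesIn (fractionSubring properDenominators) G) (hG0 : coeffMat 0 G = 0) {K : TF p q}
    (hK : K ∈ delaySpace N 𝒴) : K * (1 - G * K)⁻¹ ∈ delaySpace N 𝒴 := by
  have hK' := mem_delaySpace_iff.1 hK
  set M := G * K with hM
  have hM0 : coeffMat 0 M = 0 := by rw [hM, coeffMat_zero_mul, hG0, Matrix.zero_mul]
  have h10 : coeffMat 0 (1 - M) = 1 := by rw [coeffMat_sub, hM0, coeffMat_zero_one, sub_zero]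
  have hu := isUnit_det_of_coeffMat_zero h10
  obtain ⟨M', hM'⟩ := exists_eq_X_pow_smul (F := M) (k := 1) fun i hi => by
    rw [Nat.lt_one_iff.1 hi, hM0]
  -- The Neumann series stops after `N + 1` terms: `G K` is divisible by `1/z`, so the remainder has
  -- order at least `N + 1` and falls into the unconstrained tail.
  have hsum : K * (1 - M)⁻¹ = ∑ j ∈ Finset.range (N + 1), K * M ^ j +
      (PowerSeries.X : PowerSeries ℝ) ^ (N + 1) • (K * (M' ^ (N + 1) * (1 - M)⁻¹)) := by
    have h1 := congrArg (· * (1 - M)⁻¹) (geom_sum_mul_neg M (N + 1))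
    simp only [Matrix.sub_mul, Matrix.one_mul] at h1
    rw [Matrix.mul_nonsing_inv_cancel_right _ _ hu, eq_sub_iff_add_eq] at h1
    have h2 : M ^ (N + 1) = (PowerSeries.X : PowerSeries ℝ) ^ (N + 1) • M' ^ (N + 1) := by
      conv_lhs => rw [hM', pow_one, smul_pow]
    rw [h2, Matrix.smul_mul] at h1
    conv_lhs => rw [← h1]
    rw [Matrix.mul_add, Matrix.mul_smul, Matrix.mul_sum]
  rw [mem_delaySpace_iff]
  refine ⟨hK'.1.mul ((EntriesIn.one.sub (hG.mul hK'.1)).inv h10), ?_, fun i hi hiN => ?_⟩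
  · rw [coeffMat_zero_mul, hK'.2.1, Matrix.zero_mul]
  · rw [hsum, coeffMat_add, coeffMat_X_pow_smul_of_lt (by omega), add_zero, coeffMat_sum]
    exact (𝒴 i).sum_mem fun j _ =>
      (mem_delaySpace_iff.1 (hQI.mul_pow_mem hK j)).2.2 i hi hiN

end QuadraticallyInvariant

end DelaySpace

namespace Plant

variable {n p₁ p₂ q₁ q₂ : ℕ} {G : Plant n p₁ p₂ q₁ q₂} {X Y : Matrix (Fin n) (Fin n) ℝ}

/-! ### The Youla parametrization -/

variable (G X Y) in
/-- The map `V ↦ (Ŷ - M̂ V) M̃` from Youla parameters to closed-loop maps `K (I - G₂₂ K)⁻¹`. -/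
def youla (V : TF p₂ q₂) : TF p₂ q₂ := (G.Yhat X Y - G.Mhat X * V) * G.Mtilde Y

lemma coeffMat_zero_youla (V : TF p₂ q₂) :
    coeffMat 0 (G.youla X Y V) = -coeffMat 0 V := by
  simp [youla, coeffMat_zero_mul, coeffMat_sub, Yhat, Mhat, Mtilde]

lemma add_youla (V : TF p₂ q₂) :
    G.G₁₁ + G.G₁₂ * G.youla X Y V * G.G₂₁ = G.P₁₁ X Y - G.N₁₂ X * V * G.N₂₁ Y := by
  rw [P₁₁, ← G₁₂_mul_Mhat, ← Mtilde_mul_G₂₁, youla]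
  simp only [Matrix.mul_sub, Matrix.sub_mul, Matrix.mul_assoc]
  abel

lemma closedLoop_eq_of_youla {K V : TF p₂ q₂}
    (h : K * (1 - G.G₂₂ * K)⁻¹ = G.youla X Y V) :
    G.closedLoop K = G.P₁₁ X Y - G.N₁₂ X * V * G.N₂₁ Y := by
  rw [closedLoop, Matrix.mul_assoc G.G₁₂, h, add_youla]

/-- Both denominators have constant coefficient `1`, so the equation can be solved for `V`. The
solution need not be stable. -/
lemma exists_youla_eq (Q : TF p₂ q₂) : ∃ V, G.youla X Y V = Q := by
  have hM : IsUnit (G.Mhat X).det := isUnit_det_of_coeffMat_zero (by simp [Mhat])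
  have hM' : IsUnit (G.Mtilde Y).det := isUnit_det_of_coeffMat_zero (by simp [Mtilde])
  refine ⟨(G.Mhat X)⁻¹ * (G.Yhat X Y - Q * (G.Mtilde Y)⁻¹), ?_⟩
  rw [youla, Matrix.mul_nonsing_inv_cancel_left _ _ hM, sub_sub_cancel,
    Matrix.nonsing_inv_mul_cancel_right _ _ hM']

lemma controller_mul (V : TF p₂ q₂) :
    G.controller X Y V * (G.Xhat X Y - G.Nhat X * V) = G.Yhat X Y - G.Mhat X * V :=
  Matrix.nonsing_inv_mul_cancel_right _ _
    (isUnit_det_of_coeffMat_zero (by simp [coeffMat_sub, coeffMat_zero_mul, Xhat, Nhat]))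

lemma one_sub_mul_controller (V : TF p₂ q₂) :
    (1 - G.G₂₂ * G.controller X Y V) * ((G.Xhat X Y - G.Nhat X * V) * G.Mtilde Y) = 1 := by
  -- One-sided inverses of square matrices are two-sided, so `M̃` may be moved to the front, where
  -- the Bezout identity applies.
  rw [← Matrix.mul_assoc, mul_eq_one_comm]
  calc G.Mtilde Y * ((1 - G.G₂₂ * G.controller X Y V) * (G.Xhat X Y - G.Nhat X * V))
      = G.Mtilde Y * (G.Xhat X Y - G.Nhat X * V) - G.Mtilde Y * G.G₂₂ *
          (G.controller X Y V * (G.Xhat X Y - G.Nhat X * V)) := by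
        simp only [Matrix.sub_mul, Matrix.mul_sub, Matrix.one_mul, Matrix.mul_assoc]
        abel
    _ = (G.Mtilde Y * G.Xhat X Y - G.Mtilde Y * G.G₂₂ * G.Yhat X Y) -
        G.Mtilde Y * (G.Nhat X - G.G₂₂ * G.Mhat X) * V := by
        rw [controller_mul]
        simp only [Matrix.sub_mul, Matrix.mul_sub, Matrix.mul_assoc]
        abel
    _ = 1 := by rw [Mtilde_mul_G₂₂, bezout, G₂₂_mul_Mhat]; simp

lemma inv_one_sub_mul_controller (V : TF p₂ q₂) :
    (1 - G.G₂₂ * G.controller X Y V)⁻¹ = (G.Xhat X Y - G.Nhat X * V) * G.Mtilde Y :=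
  Matrix.inv_eq_right_inv (one_sub_mul_controller V)

lemma controller_mul_inv (V : TF p₂ q₂) :
    G.controller X Y V * (1 - G.G₂₂ * G.controller X Y V)⁻¹ = G.youla X Y V := by
  rw [inv_one_sub_mul_controller, ← Matrix.mul_assoc, controller_mul, youla]

lemma inv_one_sub_controller_mul (V : TF p₂ q₂) :
    (1 - G.controller X Y V * G.G₂₂)⁻¹ = 1 + G.youla X Y V * G.G₂₂ := by
  refine Matrix.inv_eq_right_inv ?_
  have h := one_sub_mul_controller (G := G) (X := X) (Y := Y) V
  rw [← inv_one_sub_mul_controller] at h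
  rw [← controller_mul_inv]
  set K := G.controller X Y V
  set S := (1 - G.G₂₂ * K)⁻¹
  calc (1 - K * G.G₂₂) * (1 + K * S * G.G₂₂)
      = 1 - K * G.G₂₂ + K * ((1 - G.G₂₂ * K) * S) * G.G₂₂ := by
        simp only [Matrix.sub_mul, Matrix.mul_sub, Matrix.mul_add, Matrix.one_mul, Matrix.mul_one,
          Matrix.mul_assoc]
    _ = 1 := by rw [h, Matrix.mul_one, sub_add_cancel]

/-- Inverting `Q = K (1 - G₂₂ K)⁻¹` is again a feedback formula, with `-G₂₂` in place of `G₂₂`, so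
quadratic invariance also brings `Q` back to `K`. -/
lemma controller_eq (V : TF p₂ q₂) :
    G.controller X Y V = G.youla X Y V * (1 - -G.G₂₂ * G.youla X Y V)⁻¹ := by
  have h := one_sub_mul_controller (G := G) (X := X) (Y := Y) V
  rw [← inv_one_sub_mul_controller] at h
  have h2 := h
  rw [← controller_mul_inv]
  set K := G.controller X Y V
  set S := (1 - G.G₂₂ * K)⁻¹
  have h3 : 1 - -G.G₂₂ * (K * S) = S := by
    rw [Matrix.sub_mul, Matrix.one_mul, sub_eq_iff_eq_add] at h2
    rw [Matrix.neg_mul, sub_neg_eq_add, ← Matrix.mul_assoc]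
    exact h2.symm
  rw [h3, Matrix.mul_assoc, Matrix.mul_nonsing_inv _, Matrix.mul_one]
  exact (Matrix.isUnit_iff_isUnit_det _).1 ⟨⟨S, _, mul_eq_one_comm.1 h, h⟩, rfl⟩

theorem internallyStabilizes_controller (hX : G.IsControlRiccati X) (hY : G.IsFilterRiccati Y)
    {V : TF p₂ q₂} (hV : EntriesIn (fractionSubring stableDenominators) V) :
    G.InternallyStabilizes (G.controller X Y V) := by
  have hMh : EntriesIn (fractionSubring stableDenominators) (G.Mhat X) :=
    hX.stable_AK.isStableTF_realization _ _ _
  have hNh : EntriesIn (fractionSubring stableDenominators) (G.Nhat X) :=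
    hX.stable_AK.isStableTF_realization _ _ _
  have hYh : EntriesIn (fractionSubring stableDenominators) (G.Yhat X Y) :=
    hX.stable_AK.isStableTF_realization _ _ _
  have hXh : EntriesIn (fractionSubring stableDenominators) (G.Xhat X Y) :=
    hX.stable_AK.isStableTF_realization _ _ _
  have hMt : EntriesIn (fractionSubring stableDenominators) (G.Mtilde Y) :=
    hY.stable_AL.isStableTF_realization _ _ _
  have hNt : EntriesIn (fractionSubring stableDenominators) (G.Ntilde Y) :=
    hY.stable_AL.isStableTF_realization _ _ _
  have hW := hXh.sub (hNh.mul hV)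
  have hU := hYh.sub (hMh.mul hV)
  simp only [InternallyStabilizes, isStableTF_iff]
  refine ⟨?_, ?_, ?_, ?_⟩
  · rw [inv_one_sub_mul_controller]; exact hW.mul hMt
  · rw [controller_mul_inv]; exact hU.mul hMt
  · rw [inv_one_sub_mul_controller, Matrix.mul_assoc, Mtilde_mul_G₂₂]; exact hW.mul hNt
  · rw [inv_one_sub_controller_mul, youla, Matrix.mul_assoc, Mtilde_mul_G₂₂]
    exact EntriesIn.one.add (hU.mul hNt)

/-! ### Truncation -/

lemma coeffMat_projFIR {p q : ℕ} (N i : ℕ) (V : TF p q) :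
    coeffMat i (projFIR N V) = if 1 ≤ i ∧ i ≤ N then coeffMat i V else 0 :=
  coeffMat_ofCoeffs _ _

lemma projFIR_mem_strictFIR {p q : ℕ} (N : ℕ) (V : TF p q) : projFIR N V ∈ strictFIR p q N :=
  fun i hi => by rw [coeffMat_projFIR, if_neg hi]

/-- Causality: the removed part of `V` is divisible by `z^{-(N+1)}`, and so is its image under the
linear part of the map. -/
lemma coeffMat_youla_projFIR {N i : ℕ} (hi : i ≤ N) {V : TF p₂ q₂} (hV0 : coeffMat 0 V = 0) :
    coeffMat i (G.youla X Y (projFIR N V)) = coeffMat i (G.youla X Y V) := by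
  obtain ⟨W, hW⟩ := exists_eq_X_pow_smul (F := V - projFIR N V) (k := N + 1) fun i hi => by
    rw [coeffMat_sub, coeffMat_projFIR]
    rcases i with _ | i
    · simp [hV0]
    · rw [if_pos (by omega), sub_self]
  have h : G.youla X Y (projFIR N V) - G.youla X Y V =
      (PowerSeries.X : PowerSeries ℝ) ^ (N + 1) • (G.Mhat X * W * G.Mtilde Y) := by
    rw [← Matrix.smul_mul, ← Matrix.mul_smul, ← hW, youla, youla]
    simp only [Matrix.mul_sub, Matrix.sub_mul]
    abel
  rw [← sub_eq_zero, ← coeffMat_sub, h, coeffMat_X_pow_smul_of_lt (by omega)]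

lemma qpCost_projFIR_le (N : ℕ) (V : TF p₂ q₂) :
    G.qpCost X Y (projFIR N V) ≤ G.qpCost X Y V := by
  rw [qpCost_eq, qpCost_eq]
  refine ENNReal.tsum_le_tsum fun i => ?_
  simp only [coeffMat_mul_const, coeffMat_const_mul, coeffMat_projFIR]
  split_ifs
  · exact le_rfl
  · simp

lemma mem_qpFeasible_iff {N : ℕ} {𝒴 : ℕ → Submodule ℝ (Matrix (Fin p₂) (Fin q₂) ℝ)}
    {V : TF p₂ q₂} : V ∈ G.qpFeasible X Y N 𝒴 ↔ V ∈ strictFIR p₂ q₂ N ∧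
      ∀ i, 1 ≤ i → i ≤ N → coeffMat i (G.youla X Y V) ∈ 𝒴 i := by
  refine and_congr_right fun _ => ?_
  change projFIR N (G.youla X Y V) ∈ patternFIR N 𝒴 ↔ _
  constructor
  · intro h i hi hiN
    have := h.2 i hi hiN
    rwa [coeffMat_projFIR, if_pos ⟨hi, hiN⟩] at this
  · intro h
    refine ⟨projFIR_mem_strictFIR _ _, fun i hi hiN => ?_⟩
    rw [coeffMat_projFIR, if_pos ⟨hi, hiN⟩]
    exact h i hi hiN

/-! ### Reduction of the decentralized problem to the quadratic program -/

section Reduction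

variable {N : ℕ} {𝒴 : ℕ → Submodule ℝ (Matrix (Fin p₂) (Fin q₂) ℝ)}

lemma entriesIn_of_mem_strictFIR (S : Submonoid (Polynomial ℝ)) {V : TF p₂ q₂}
    (hV : V ∈ strictFIR p₂ q₂ N) : EntriesIn (fractionSubring S) V :=
  entriesIn_of_coeffMat_eq_zero S fun i (hi : N < i) => hV i (by omega)

theorem controller_mem_delaySpace (hQI : QuadraticallyInvariant (delaySpace N 𝒴) G.G₂₂)
    {V : TF p₂ q₂} (hV : V ∈ G.qpFeasible X Y N 𝒴) :
    G.controller X Y V ∈ delaySpace N 𝒴 := by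
  rw [mem_qpFeasible_iff] at hV
  rw [controller_eq]
  refine hQI.neg.feedback_mem (isProperRational_realization _ _ _ _).neg
    (by simp [coeffMat_neg, G₂₂]) (mem_delaySpace_iff.2 ⟨?_, ?_, hV.2⟩)
  · exact ((isProperRational_realization _ _ _ _).sub ((isProperRational_realization _ _ _ _).mul
      (entriesIn_of_mem_strictFIR _ hV.1))).mul (isProperRational_realization _ _ _ _)
  · rw [coeffMat_zero_youla, hV.1 0 (by omega), neg_zero]

lemma isH2_of_mem_strictFIR {V : TF p₂ q₂} (hV : V ∈ strictFIR p₂ q₂ N) : IsH2 V := fun a b =>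
  summable_of_ne_finset_zero (s := Finset.range (N + 1)) fun i hi => by
    have : coeffMat i V a b = 0 := by rw [hV i (by simp at hi; omega)]; rfl
    rw [← coeffMat_apply, this, sq, mul_zero]

theorem h2NormSq_closedLoop_controller (hG : G.Standing) (hX : G.IsControlRiccati X)
    (hY : G.IsFilterRiccati Y) {V : TF p₂ q₂} (hV : V ∈ strictFIR p₂ q₂ N) :
    h2NormSq (G.closedLoop (G.controller X Y V)) =
      h2NormSq (G.P₁₁ X Y) + G.qpCost X Y V := by
  rw [closedLoop_eq_of_youla (controller_mul_inv V)]
  exact h2NormSq_P₁₁_sub hG hX hY (isH2_of_mem_strictFIR hV) (hV 0 (by omega))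

/-- Every admissible controller costs at least as much as some feasible point of the quadratic
program. -/
theorem exists_qpFeasible_le (hG : G.Standing) (hX : G.IsControlRiccati X)
    (hY : G.IsFilterRiccati Y) (hQI : QuadraticallyInvariant (delaySpace N 𝒴) G.G₂₂)
    {K : TF p₂ q₂} (hK : K ∈ delaySpace N 𝒴) (hfin : h2NormSq (G.closedLoop K) ≠ ⊤) :
    ∃ V ∈ G.qpFeasible X Y N 𝒴,
      h2NormSq (G.P₁₁ X Y) + G.qpCost X Y V ≤ h2NormSq (G.closedLoop K) := by
  obtain ⟨V, hV⟩ := exists_youla_eq (G := G) (X := X) (Y := Y) (K * (1 - G.G₂₂ * K)⁻¹)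
  have hQ := mem_delaySpace_iff.1
    (hQI.feedback_mem (isProperRational_realization _ _ _ _) (by simp [G₂₂]) hK)
  have hV0 : coeffMat 0 V = 0 := by
    rw [← neg_eq_zero, ← coeffMat_zero_youla (G := G) (X := X) (Y := Y), hV, hQ.2.1]
  rw [closedLoop_eq_of_youla hV.symm] at hfin ⊢
  -- Finite cost is what puts the possibly unstable `V` in `H₂`, as the cost formula requires.
  have hVH := isH2_of_isH2_P₁₁_sub hG hX hY (isH2_iff_h2NormSq_ne_top.2 hfin)
  rw [h2NormSq_P₁₁_sub hG hX hY hVH hV0]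
  refine ⟨projFIR N V, mem_qpFeasible_iff.2 ⟨projFIR_mem_strictFIR _ _, fun i hi hiN => ?_⟩,
    by gcongr; exact qpCost_projFIR_le N V⟩
  rw [coeffMat_youla_projFIR hiN hV0, hV]
  exact hQ.2.2 i hi hiN

end Reduction

end Plant

/-! ### Finite-horizon linear-quadratic control -/

lemma mulVec_dotProduct_eq {ι κ : Type*} [Fintype ι] [Fintype κ] (A : Matrix ι κ ℝ) (x : κ → ℝ)
    (w : ι → ℝ) : (A *ᵥ x) ⬝ᵥ w = x ⬝ᵥ (Aᵀ *ᵥ w) := by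
  rw [Matrix.mulVec_transpose, dotProduct_comm, Matrix.dotProduct_mulVec, dotProduct_comm]

namespace TVSystem

variable {σ ρ : Type} [Fintype σ] [Fintype ρ] {d : ℕ → ℕ} (T : TVSystem σ ρ d)

/-- The weight `Dᵢᵀ Dᵢ + Bᵢᵀ P Bᵢ` of the input deviation. -/
def weight (i : ℕ) (P : Matrix σ σ ℝ) : Matrix (Fin (d i)) (Fin (d i)) ℝ :=
  (T.D i)ᵀ * T.D i + (T.B i)ᵀ * P * T.B i

/-- The gain `-(Dᵢᵀ Dᵢ + Bᵢᵀ P Bᵢ)⁻¹ (Bᵢᵀ P Aᵢ + Dᵢᵀ Cᵢ)`. -/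
def gainStep (i : ℕ) (P : Matrix σ σ ℝ) : Matrix (Fin (d i)) σ ℝ :=
  -((T.weight i P)⁻¹ * ((T.B i)ᵀ * P * T.A i + (T.D i)ᵀ * T.C i))

lemma gain_eq (N i : ℕ) : T.gain N i = T.gainStep i (T.riccati N (i + 1)) := rfl

variable {T}

lemma posDef_weight {i : ℕ} {P : Matrix σ σ ℝ} (hD : ((T.D i)ᵀ * T.D i).PosDef)
    (hP : P.PosSemidef) : (T.weight i P).PosDef := by
  have := hP.conjTranspose_mul_mul_same (T.B i)
  rw [conjTranspose_eq_transpose_of_trivial] at this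
  exact hD.add_posSemidef this

/-- Completion of squares in one step of the recursion. -/
lemma step_cost {i : ℕ} {P : Matrix σ σ ℝ} (hD : ((T.D i)ᵀ * T.D i).PosDef)
    (hP : P.PosSemidef) (x : σ → ℝ) (u : Fin (d i) → ℝ) :
    (T.C i *ᵥ x + T.D i *ᵥ u) ⬝ᵥ (T.C i *ᵥ x + T.D i *ᵥ u) +
      (T.A i *ᵥ x + T.B i *ᵥ u) ⬝ᵥ (P *ᵥ (T.A i *ᵥ x + T.B i *ᵥ u)) =
    x ⬝ᵥ (T.riccatiStep i P *ᵥ x) +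
      (u - T.gainStep i P *ᵥ x) ⬝ᵥ (T.weight i P *ᵥ (u - T.gainStep i P *ᵥ x)) := by
  have hS := posDef_weight hD hP
  have hu : IsUnit (T.weight i P).det := hS.det_pos.ne'.isUnit
  have hPt : Pᵀ = P := by
    rw [← conjTranspose_eq_transpose_of_trivial]; exact hP.isHermitian
  have hSt : (T.weight i P)ᵀ = T.weight i P := by
    rw [← conjTranspose_eq_transpose_of_trivial]; exact hS.isHermitian
  obtain ⟨M, hM⟩ : ∃ M, (T.B i)ᵀ * P * T.A i + (T.D i)ᵀ * T.C i = M := ⟨_, rfl⟩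
  obtain ⟨S, hSd⟩ : ∃ S, T.weight i P = S := ⟨_, rfl⟩
  have hMt : (T.A i)ᵀ * P * T.B i + (T.C i)ᵀ * T.D i = Mᵀ := by
    rw [← hM]
    simp [Matrix.transpose_mul, hPt, Matrix.mul_assoc]
  have hric : T.riccatiStep i P =
      (T.C i)ᵀ * T.C i + (T.A i)ᵀ * P * T.A i - Mᵀ * S⁻¹ * M := by
    rw [riccatiStep, hM, hMt, ← hSd]; rfl
  have hgain : T.gainStep i P = -(S⁻¹ * M) := by rw [gainStep, hM, hSd]
  rw [hSd] at hu hSt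
  have hsw : ∀ (y : Fin (d i) → ℝ), x ⬝ᵥ (Mᵀ *ᵥ y) = y ⬝ᵥ (M *ᵥ x) := fun y => by
    rw [← mulVec_dotProduct_eq, dotProduct_comm]
  have hlhs : (T.C i *ᵥ x + T.D i *ᵥ u) ⬝ᵥ (T.C i *ᵥ x + T.D i *ᵥ u) +
      (T.A i *ᵥ x + T.B i *ᵥ u) ⬝ᵥ (P *ᵥ (T.A i *ᵥ x + T.B i *ᵥ u)) =
      x ⬝ᵥ (((T.C i)ᵀ * T.C i + (T.A i)ᵀ * P * T.A i) *ᵥ x) + x ⬝ᵥ (Mᵀ *ᵥ u) + u ⬝ᵥ (M *ᵥ x) +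
        u ⬝ᵥ (S *ᵥ u) := by
    rw [← hMt, ← hM, ← hSd, weight]
    simp only [Matrix.mulVec_add, Matrix.add_mulVec, dotProduct_add, add_dotProduct,
      mulVec_dotProduct_eq, Matrix.mulVec_mulVec, Matrix.mul_assoc]
    ring
  have hrhs : (u - -(S⁻¹ * M) *ᵥ x) ⬝ᵥ (S *ᵥ (u - -(S⁻¹ * M) *ᵥ x)) =
      u ⬝ᵥ (S *ᵥ u) + 2 * u ⬝ᵥ (M *ᵥ x) + x ⬝ᵥ ((Mᵀ * S⁻¹ * M) *ᵥ x) := by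
    have e1 : S *ᵥ (u - -(S⁻¹ * M) *ᵥ x) = S *ᵥ u + M *ᵥ x := by
      rw [Matrix.neg_mulVec, sub_neg_eq_add, Matrix.mulVec_add, Matrix.mulVec_mulVec,
        Matrix.mul_nonsing_inv_cancel_left _ _ hu]
    have e2 : (S⁻¹ * M) *ᵥ x ⬝ᵥ S *ᵥ u = u ⬝ᵥ (M *ᵥ x) := by
      rw [mulVec_dotProduct_eq, Matrix.mulVec_mulVec, Matrix.transpose_mul,
        Matrix.transpose_nonsing_inv, hSt, Matrix.nonsing_inv_mul_cancel_right _ _ hu, hsw]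
    have e3 : (S⁻¹ * M) *ᵥ x ⬝ᵥ M *ᵥ x = x ⬝ᵥ ((Mᵀ * S⁻¹ * M) *ᵥ x) := by
      rw [mulVec_dotProduct_eq, Matrix.mulVec_mulVec, Matrix.transpose_mul,
        Matrix.transpose_nonsing_inv, hSt]
    rw [e1, Matrix.neg_mulVec, sub_neg_eq_add, add_dotProduct, dotProduct_add, dotProduct_add,
      e2, e3]
    ring
  rw [hlhs, hgain, hSd, hrhs, hric, hsw, Matrix.sub_mulVec, dotProduct_sub]
  ring

/-- At the optimal input the completed square vanishes, so the new quadratic form equals a stage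
cost plus a storage term, both nonnegative. -/
lemma posSemidef_riccatiStep {i : ℕ} {P : Matrix σ σ ℝ} (hD : ((T.D i)ᵀ * T.D i).PosDef)
    (hP : P.PosSemidef) : (T.riccatiStep i P).PosSemidef := by
  have hPt : Pᵀ = P := by
    rw [← conjTranspose_eq_transpose_of_trivial]; exact hP.isHermitian
  have hSt : (T.weight i P)ᵀ = T.weight i P := by
    rw [← conjTranspose_eq_transpose_of_trivial]; exact (posDef_weight hD hP).isHermitian
  refine PosSemidef.of_dotProduct_mulVec_nonneg ?_ fun x => ?_
  · rw [IsHermitian, conjTranspose_eq_transpose_of_trivial]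
    have : T.riccatiStep i P = (T.C i)ᵀ * T.C i + (T.A i)ᵀ * P * T.A i
        - ((T.A i)ᵀ * P * T.B i + (T.C i)ᵀ * T.D i) * (T.weight i P)⁻¹
          * ((T.B i)ᵀ * P * T.A i + (T.D i)ᵀ * T.C i) := rfl
    rw [this]
    simp only [Matrix.transpose_sub, Matrix.transpose_add, Matrix.transpose_mul, hPt,
      Matrix.transpose_transpose, Matrix.transpose_nonsing_inv, hSt, Matrix.mul_assoc]
  · have h := step_cost hD hP x (T.gainStep i P *ᵥ x)
    rw [sub_self, zero_dotProduct, add_zero] at h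
    rw [star_trivial, ← h]
    refine add_nonneg (Finset.sum_nonneg fun _ _ => mul_self_nonneg _) ?_
    have := hP.dotProduct_mulVec_nonneg (T.A i *ᵥ x + T.B i *ᵥ (T.gainStep i P *ᵥ x))
    rwa [star_trivial] at this

lemma riccati_of_le {N i : ℕ} (h : i ≤ N) :
    T.riccati N i = T.riccatiStep i (T.riccati N (i + 1)) := by
  rw [riccati, if_pos h]

lemma riccati_of_gt {N i : ℕ} (h : N < i) : T.riccati N i = 0 := by
  rw [riccati, if_neg h.not_ge]

lemma posSemidef_riccati {N : ℕ} (hD : ∀ i, 1 ≤ i → i ≤ N → ((T.D i)ᵀ * T.D i).PosDef)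
    {i : ℕ} (hi : 1 ≤ i) : (T.riccati N i).PosSemidef := by
  -- Backward induction on the number of remaining steps, starting from `X_{N+1} = 0`.
  obtain ⟨k, hk⟩ : ∃ k, N + 1 - i = k := ⟨_, rfl⟩
  induction k generalizing i with
  | zero => rw [riccati_of_gt (by omega)]; exact PosSemidef.zero
  | succ k ih =>
    rw [riccati_of_le (by omega)]
    exact posSemidef_riccatiStep (hD i hi (by omega)) (ih (by omega) (by omega))

/-- The excess cost of the input `u` over the optimal feedback. -/
def deviation (T : TVSystem σ ρ d) (N i : ℕ) (x : σ → ℝ) (u : Fin (d i) → ℝ) : ℝ :=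
  (u - T.gain N i *ᵥ x) ⬝ᵥ (T.weight i (T.riccati N (i + 1)) *ᵥ (u - T.gain N i *ᵥ x))

lemma deviation_nonneg {N i : ℕ} (hD : ∀ i, 1 ≤ i → i ≤ N → ((T.D i)ᵀ * T.D i).PosDef)
    (hi : 1 ≤ i) (hiN : i ≤ N) (x : σ → ℝ) (u : Fin (d i) → ℝ) : 0 ≤ T.deviation N i x u := by
  have := (posDef_weight (hD i hi hiN) (posSemidef_riccati hD (N := N) (i := i + 1)
    (by omega))).posSemidef.dotProduct_mulVec_nonneg (u - T.gain N i *ᵥ x)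
  rwa [star_trivial] at this

lemma eq_of_deviation_eq_zero {N i : ℕ}
    (hD : ∀ i, 1 ≤ i → i ≤ N → ((T.D i)ᵀ * T.D i).PosDef)
    (hi : 1 ≤ i) (hiN : i ≤ N) {x : σ → ℝ} {u : Fin (d i) → ℝ} (h : T.deviation N i x u = 0) :
    u = T.gain N i *ᵥ x := by
  by_contra hne
  have hpos := (posDef_weight (hD i hi hiN)
    (posSemidef_riccati hD (N := N) (i := i + 1) (by omega))).dotProduct_mulVec_pos
      (sub_ne_zero.2 hne)
  rw [star_trivial] at hpos
  exact hpos.ne' h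

/-- The cost of any trajectory is the optimal cost plus the sum of the deviations. -/
theorem sum_cost_eq {N : ℕ} (hD : ∀ i, 1 ≤ i → i ≤ N → ((T.D i)ᵀ * T.D i).PosDef)
    {x : ℕ → σ → ℝ} {u : (i : ℕ) → Fin (d i) → ℝ}
    (hx : ∀ i, 1 ≤ i → i ≤ N → x (i + 1) = T.A i *ᵥ x i + T.B i *ᵥ u i) :
    ∑ i ∈ Finset.Icc 1 N, (T.C i *ᵥ x i + T.D i *ᵥ u i) ⬝ᵥ (T.C i *ᵥ x i + T.D i *ᵥ u i) =
      x 1 ⬝ᵥ (T.riccati N 1 *ᵥ x 1) + ∑ i ∈ Finset.Icc 1 N, T.deviation N i (x i) (u i) := by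
  have key : ∀ m, m ≤ N →
      ∑ i ∈ Finset.Icc 1 m, (T.C i *ᵥ x i + T.D i *ᵥ u i) ⬝ᵥ (T.C i *ᵥ x i + T.D i *ᵥ u i) +
        x (m + 1) ⬝ᵥ (T.riccati N (m + 1) *ᵥ x (m + 1)) =
      x 1 ⬝ᵥ (T.riccati N 1 *ᵥ x 1) + ∑ i ∈ Finset.Icc 1 m, T.deviation N i (x i) (u i) := by
    intro m
    induction m with
    | zero => intro _; simp
    | succ m ih =>
      intro hm
      have h := step_cost (hD (m + 1) (by omega) hm)
        (posSemidef_riccati hD (N := N) (i := m + 1 + 1) (by omega)) (x (m + 1)) (u (m + 1))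
      rw [← hx (m + 1) (by omega) hm, ← riccati_of_le hm, ← gain_eq] at h
      rw [Finset.sum_Icc_succ_top (by omega), Finset.sum_Icc_succ_top (by omega), ← add_assoc,
        ← ih (by omega), add_assoc, h, deviation]
      ring
  have h := key N le_rfl
  rwa [riccati_of_gt (Nat.lt_succ_self N), Matrix.zero_mulVec, dotProduct_zero, add_zero] at h

end TVSystem

/-! ### Orthonormal bases of a pattern and of its complement -/

section Orthonormal

variable {p q e f : ℕ} {U : Submodule ℝ (Matrix (Fin p) (Fin q) ℝ)}
  {E : Matrix (VecIdx p q) (Fin e) ℝ} {F : Matrix (VecIdx p q) (Fin f) ℝ}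

lemma trace_mul_transpose_eq_vec_dotProduct (M Z : Matrix (Fin p) (Fin q) ℝ) :
    (M * Zᵀ).trace = M.vec ⬝ᵥ Z.vec := by
  rw [Matrix.vec_dotProduct_vec, ← Matrix.trace_transpose, Matrix.transpose_mul,
    Matrix.transpose_transpose, Matrix.trace_mul_comm]

lemma exists_vec_eq (v : VecIdx p q → ℝ) : ∃ M : Matrix (Fin p) (Fin q) ℝ, M.vec = v :=
  Matrix.vec_bijective.2 v

lemma IsOrthonormalBasisOf.mulVec_mem {ι κ : Type} [Fintype ι] [Fintype κ] [DecidableEq κ]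
    {E : Matrix ι κ ℝ} {W : Set (ι → ℝ)} (h : IsOrthonormalBasisOf E W) (u : κ → ℝ) :
    E *ᵥ u ∈ W := by
  rw [← h.2, SetLike.mem_coe, ← Matrix.range_mulVecLin]
  exact ⟨u, rfl⟩

lemma IsOrthonormalBasisOf.exists_mulVec_eq {ι κ : Type} [Fintype ι] [Fintype κ] [DecidableEq κ]
    {E : Matrix ι κ ℝ} {W : Set (ι → ℝ)} (h : IsOrthonormalBasisOf E W) {w : ι → ℝ} (hw : w ∈ W) :
    ∃ u, E *ᵥ u = w := by
  rw [← h.2, SetLike.mem_coe, ← Matrix.range_mulVecLin] at hw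
  exact hw

lemma dotProduct_eq_zero_of_mem {v w : VecIdx p q → ℝ} (hv : v ∈ vecSet U)
    (hw : w ∈ vecPerpSet U) : w ⬝ᵥ v = 0 := by
  obtain ⟨Z, hZ, rfl⟩ := hv
  obtain ⟨M, hM, rfl⟩ := hw
  rw [← trace_mul_transpose_eq_vec_dotProduct, hM Z hZ]

lemma transpose_mul_eq_zero (hE : IsOrthonormalBasisOf E (vecSet U))
    (hF : IsOrthonormalBasisOf F (vecPerpSet U)) : Fᵀ * E = 0 := by
  refine Matrix.ext_of_mulVec_single fun i => ?_
  rw [← Matrix.mulVec_mulVec, Matrix.zero_mulVec, ← dotProduct_self_eq_zero,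
    ← mulVec_dotProduct_eq F]
  rw [dotProduct_eq_zero_of_mem (hE.mulVec_mem _) (hF.mulVec_mem _)]

/-- `E Eᵀ + F Fᵀ = 1`. -/
lemma mulVec_add_mulVec (hE : IsOrthonormalBasisOf E (vecSet U))
    (hF : IsOrthonormalBasisOf F (vecPerpSet U)) (v : VecIdx p q → ℝ) :
    E *ᵥ (Eᵀ *ᵥ v) + F *ᵥ (Fᵀ *ᵥ v) = v := by
  have hFE := transpose_mul_eq_zero hE hF
  have hEF : Eᵀ * F = 0 := by simpa using congrArg Matrix.transpose hFE
  -- The residual `w` satisfies `Eᵀ w = 0`, which places it in the complement and hence in the range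
  -- of `F`; then `Fᵀ w = 0` forces `w = 0`.
  obtain ⟨w, hw⟩ : ∃ w, v - (E *ᵥ (Eᵀ *ᵥ v) + F *ᵥ (Fᵀ *ᵥ v)) = w := ⟨_, rfl⟩
  have hEw : Eᵀ *ᵥ w = 0 := by
    rw [← hw]
    simp only [Matrix.mulVec_sub, Matrix.mulVec_add, Matrix.mulVec_mulVec, ← Matrix.mul_assoc,
      hE.1, hEF]
    simp
  have hFw : Fᵀ *ᵥ w = 0 := by
    rw [← hw]
    simp only [Matrix.mulVec_sub, Matrix.mulVec_add, Matrix.mulVec_mulVec, ← Matrix.mul_assoc,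
      hF.1, hFE]
    simp
  have hmem : w ∈ vecPerpSet U := by
    obtain ⟨M, rfl⟩ := exists_vec_eq w
    refine ⟨M, fun Z hZ => ?_, rfl⟩
    obtain ⟨u, hu⟩ := hE.exists_mulVec_eq ⟨Z, hZ, rfl⟩
    rw [trace_mul_transpose_eq_vec_dotProduct, ← hu, dotProduct_comm, mulVec_dotProduct_eq, hEw,
      dotProduct_zero]
  obtain ⟨u, hu⟩ := hF.exists_mulVec_eq hmem
  have hww : w ⬝ᵥ w = 0 := by
    conv_lhs => rw [← hu, mulVec_dotProduct_eq, hu, hFw, dotProduct_zero]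
  rw [dotProduct_self_eq_zero] at hww
  rw [hww] at hw
  exact (sub_eq_zero.1 hw).symm

lemma mem_iff_transpose_mulVec_vec_eq_zero (hE : IsOrthonormalBasisOf E (vecSet U))
    (hF : IsOrthonormalBasisOf F (vecPerpSet U)) (Q : Matrix (Fin p) (Fin q) ℝ) :
    Q ∈ U ↔ Fᵀ *ᵥ Q.vec = 0 := by
  constructor
  · intro hQ
    rw [← dotProduct_self_eq_zero, ← mulVec_dotProduct_eq]
    exact dotProduct_eq_zero_of_mem ⟨Q, hQ, rfl⟩ (hF.mulVec_mem _)
  · intro h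
    have h1 := mulVec_add_mulVec hE hF Q.vec
    rw [h, Matrix.mulVec_zero, add_zero] at h1
    obtain ⟨Z, hZ, hZ'⟩ := hE.mulVec_mem (Eᵀ *ᵥ Q.vec)
    rw [h1, Matrix.vec_inj] at hZ'
    rwa [hZ']

end Orthonormal

namespace Plant

variable {n p₁ p₂ q₁ q₂ : ℕ} {G : Plant n p₁ p₂ q₁ q₂} {X Y : Matrix (Fin n) (Fin n) ℝ}

/-! ### The vectorized recursion -/

section VecState

variable (G X Y) in
/-- The state `(zI - A_K)⁻¹ (L + B₂ V)`. -/
def regulatorState (V : TF p₂ q₂) : TF n q₂ :=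
  resolventTF (G.AK X) * (const (G.gainL Y) + const G.B₂ * V)

variable (G X Y) in
/-- The state `(K ξ + V) C₂ (zI - A_L)⁻¹`, where `ξ` is the regulator state. -/
def estimatorState (V : TF p₂ q₂) : TF p₂ n :=
  (const (G.gainK X) * G.regulatorState X Y V + V) * const G.C₂ * resolventTF (G.AL Y)

variable (G X Y) in
/-- The vectorized state at time `i`. -/
def vecState (V : TF p₂ q₂) (i : ℕ) : VecState n p₂ q₂ → ℝ :=
  Sum.elim (coeffMat i (G.regulatorState X Y V)).vec (coeffMat i (G.estimatorState X Y V)).vec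

lemma coeffMat_zero_regulatorState (V : TF p₂ q₂) :
    coeffMat 0 (G.regulatorState X Y V) = 0 := by
  simp [regulatorState, coeffMat_zero_mul]

lemma coeffMat_succ_regulatorState (V : TF p₂ q₂) (i : ℕ) :
    coeffMat (i + 1) (G.regulatorState X Y V) = (if i = 0 then G.gainL Y else 0) +
      G.B₂ * coeffMat i V + G.AK X * coeffMat i (G.regulatorState X Y V) := by
  conv_lhs => rw [regulatorState, resolventTF_eq, Matrix.smul_mul, Matrix.add_mul, Matrix.one_mul,
    Matrix.mul_assoc, ← regulatorState]
  rw [coeffMat_succ_X_smul, coeffMat_add, coeffMat_add, coeffMat_const_mul, coeffMat_const_mul,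
    coeffMat_const]

lemma coeffMat_succ_estimatorState (V : TF p₂ q₂) (i : ℕ) :
    coeffMat (i + 1) (G.estimatorState X Y V) =
      (G.gainK X * coeffMat i (G.regulatorState X Y V) + coeffMat i V) * G.C₂ +
        coeffMat i (G.estimatorState X Y V) * G.AL Y := by
  conv_lhs => rw [estimatorState, resolventTF_eq', Matrix.mul_smul, Matrix.mul_add, Matrix.mul_one,
    ← Matrix.mul_assoc, ← estimatorState]
  rw [coeffMat_succ_X_smul, coeffMat_add, coeffMat_mul_const, coeffMat_mul_const, coeffMat_add,
    coeffMat_const_mul]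

lemma vecState_one {V : TF p₂ q₂} (hV0 : coeffMat 0 V = 0) :
    G.vecState X Y V 1 = G.vecInit Y := by
  rw [vecState, vecInit, coeffMat_succ_regulatorState, coeffMat_succ_estimatorState,
    coeffMat_zero_regulatorState, hV0, estimatorState, coeffMat_zero_mul,
    coeffMat_zero_resolventTF]
  simp

lemma Av_mulVec (M : Matrix (Fin n) (Fin q₂) ℝ) (Z : Matrix (Fin p₂) (Fin n) ℝ) :
    G.Av X Y *ᵥ Sum.elim M.vec Z.vec =
      Sum.elim (G.AK X * M).vec (G.gainK X * M * G.C₂ + Z * G.AL Y).vec := by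
  rw [Av, Matrix.fromBlocks_mulVec]
  simp [Matrix.kronecker_mulVec_vec]

lemma Bv_mulVec (M : Matrix (Fin p₂) (Fin q₂) ℝ) :
    G.Bv *ᵥ M.vec = Sum.elim (G.B₂ * M).vec (M * G.C₂).vec := by
  rw [Bv, Matrix.fromRows_mulVec]
  simp [Matrix.kronecker_mulVec_vec]

lemma Cv_mulVec (M : Matrix (Fin n) (Fin q₂) ℝ) (Z : Matrix (Fin p₂) (Fin n) ℝ) :
    G.Cv X Y *ᵥ Sum.elim M.vec Z.vec = (G.gainK X * M + Z * G.gainL Y).vec := by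
  rw [Cv, Matrix.fromCols_mulVec]
  simp [Matrix.kronecker_mulVec_vec]

/-- The impulse `L` acts only at time `0` and has become the initial state at time `1`; this is why
`i ≥ 1` is required. -/
lemma vecState_succ (V : TF p₂ q₂) {i : ℕ} (hi : 1 ≤ i) :
    G.vecState X Y V (i + 1) =
      G.Av X Y *ᵥ G.vecState X Y V i + G.Bv *ᵥ (coeffMat i V).vec := by
  rw [vecState, vecState, Av_mulVec, Bv_mulVec, coeffMat_succ_regulatorState,
    coeffMat_succ_estimatorState, if_neg (by omega), ← Sum.elim_add_add, ← Matrix.vec_add,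
    ← Matrix.vec_add]
  congr 2
  · abel
  · rw [Matrix.add_mul]; abel

/-- Up to sign, `(Ŷ - M̂ V) M̃` is the output `K ξ + V + η L` of the two states `ξ` and `η`. Since
`V` enters with direct feedthrough, membership in `𝒴ᵢ` can be solved for part of `Vᵢ`. -/
lemma vec_coeffMat_youla (V : TF p₂ q₂) (i : ℕ) :
    (coeffMat i (G.youla X Y V)).vec =
      -(G.Cv X Y *ᵥ G.vecState X Y V i + (coeffMat i V).vec) := by
  have h : G.youla X Y V = -(const (G.gainK X) * G.regulatorState X Y V + V +
      G.estimatorState X Y V * const (G.gainL Y)) := by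
    rw [estimatorState, regulatorState, youla, Yhat, Mhat, Mtilde]
    simp only [realization_eq, const_neg, const_zero, const_one, Matrix.mul_add, Matrix.add_mul,
      Matrix.mul_neg, Matrix.neg_mul, Matrix.mul_assoc, Matrix.sub_mul, Matrix.mul_one,
      Matrix.one_mul, add_zero]
    abel
  rw [vecState, Cv_mulVec, ← Matrix.vec_add, ← Matrix.vec_neg, h, coeffMat_neg, coeffMat_add,
    coeffMat_add, coeffMat_const_mul, coeffMat_mul_const]
  congr 2
  abel

end VecState

/-! ### The quadratic program as a linear-quadratic control problem -/

lemma sqrtMat_mulVec_dotProduct {ι : Type} [Fintype ι] [DecidableEq ι] {R : Matrix ι ι ℝ}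
    (hR : R.PosSemidef) (w : ι → ℝ) :
    (sqrtMat R *ᵥ w) ⬝ᵥ (sqrtMat R *ᵥ w) = w ⬝ᵥ (R *ᵥ w) := by
  rw [mulVec_dotProduct_eq, Matrix.mulVec_mulVec, sqrtMat_transpose, sqrtMat_mul_self hR]

lemma posDef_vecR (hG : G.Standing) (hX : G.IsControlRiccati X) (hY : G.IsFilterRiccati Y) :
    (G.vecR X Y).PosDef := (hY.posDef_Ψ hG).kronecker (hX.posDef_Ω hG)

lemma qpCost_eq_sum {N : ℕ} (hG : G.Standing) (hX : G.IsControlRiccati X)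
    (hY : G.IsFilterRiccati Y) {V : TF p₂ q₂} (hV : V ∈ strictFIR p₂ q₂ N) :
    G.qpCost X Y V = ENNReal.ofReal (∑ i ∈ Finset.Icc 1 N,
      (sqrtMat (G.vecR X Y) *ᵥ (coeffMat i V).vec) ⬝ᵥ
        (sqrtMat (G.vecR X Y) *ᵥ (coeffMat i V).vec)) := by
  -- Both sides equal the quadratic form of `Ψ ⊗ Ω` at `vec M`. Only squares of the roots occur, so
  -- `R^{1/2}` need not be identified with `Ψ^{1/2} ⊗ Ω^{1/2}`.
  have hterm : ∀ M : Matrix (Fin p₂) (Fin q₂) ℝ,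
      (sqrtMat (G.Ω X) * M * sqrtMat (G.Ψ Y) * (sqrtMat (G.Ω X) * M * sqrtMat (G.Ψ Y))ᵀ).trace =
        (sqrtMat (G.vecR X Y) *ᵥ M.vec) ⬝ᵥ (sqrtMat (G.vecR X Y) *ᵥ M.vec) := by
    intro M
    have h1 : sqrtMat (G.Ω X) * M * sqrtMat (G.Ψ Y) * (sqrtMat (G.Ω X) * M * sqrtMat (G.Ψ Y))ᵀ =
        sqrtMat (G.Ω X) * (M * G.Ψ Y * Mᵀ * sqrtMat (G.Ω X)) := by
      conv_rhs => rw [← sqrtMat_mul_self (hY.posDef_Ψ hG).posSemidef]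
      simp only [Matrix.transpose_mul, sqrtMat_transpose, Matrix.mul_assoc]
    rw [h1, Matrix.trace_mul_comm, Matrix.mul_assoc,
      sqrtMat_mul_self (hX.posDef_Ω hG).posSemidef,
      sqrtMat_mulVec_dotProduct (posDef_vecR hG hX hY).posSemidef, vecR,
      Matrix.kronecker_mulVec_vec, Ψ_transpose hY.symm, Matrix.vec_dotProduct_vec,
      Matrix.mul_assoc, Matrix.trace_mul_comm (M * G.Ψ Y), Matrix.mul_assoc, Matrix.mul_assoc]
  rw [qpCost_eq, h2NormSq, tsum_eq_sum (s := Finset.Icc 1 N), ENNReal.ofReal_sum_of_nonneg]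
  · refine Finset.sum_congr rfl fun i _ => ?_
    rw [coeffMat_mul_const, coeffMat_const_mul, ← hterm]
  · exact fun i _ => Finset.sum_nonneg fun _ _ => mul_self_nonneg _
  · intro i hi
    rw [coeffMat_mul_const, coeffMat_const_mul, hV i (by simpa using hi)]
    simp

section Program

variable {N : ℕ} {𝒴 : ℕ → Submodule ℝ (Matrix (Fin p₂) (Fin q₂) ℝ)} {e f : ℕ → ℕ}
  {E : (i : ℕ) → Matrix (VecIdx p₂ q₂) (Fin (e i)) ℝ}
  {F : (i : ℕ) → Matrix (VecIdx p₂ q₂) (Fin (f i)) ℝ}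

lemma posDef_vecSystem_D (hG : G.Standing) (hX : G.IsControlRiccati X) (hY : G.IsFilterRiccati Y)
    (hE : ∀ i, 1 ≤ i → i ≤ N → IsOrthonormalBasisOf (E i) (vecSet (𝒴 i))) (i : ℕ) (hi : 1 ≤ i)
    (hiN : i ≤ N) : (((G.vecSystem X Y E F).D i)ᵀ * (G.vecSystem X Y E F).D i).PosDef := by
  have hinj : Function.Injective (E i).mulVec := by
    intro u w huw
    have := congrArg ((E i)ᵀ *ᵥ ·) huw
    simpa [Matrix.mulVec_mulVec, (hE i hi hiN).1] using this
  have h := (posDef_vecR hG hX hY).conjTranspose_mul_mul_same hinj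
  rw [conjTranspose_eq_transpose_of_trivial] at h
  have e1 : ((G.vecSystem X Y E F).D i)ᵀ * (G.vecSystem X Y E F).D i =
      (E i)ᵀ * G.vecR X Y * E i := by
    change (sqrtMat (G.vecR X Y) * E i)ᵀ * (sqrtMat (G.vecR X Y) * E i) = _
    conv_rhs => rw [← sqrtMat_mul_self (posDef_vecR hG hX hY).posSemidef]
    simp only [Matrix.transpose_mul, sqrtMat_transpose, Matrix.mul_assoc]
  rwa [e1]

/-- Feasible points are parametrized by the free inputs `uᵢ = Eᵢᵀ vec Vᵢ`. -/
lemma mem_pattern_iff (hE : ∀ i, 1 ≤ i → i ≤ N → IsOrthonormalBasisOf (E i) (vecSet (𝒴 i)))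
    (hF : ∀ i, 1 ≤ i → i ≤ N → IsOrthonormalBasisOf (F i) (vecPerpSet (𝒴 i)))
    (V : TF p₂ q₂) {i : ℕ} (hi : 1 ≤ i) (hiN : i ≤ N) :
    coeffMat i (G.youla X Y V) ∈ 𝒴 i ↔
      (coeffMat i V).vec = E i *ᵥ ((E i)ᵀ *ᵥ (coeffMat i V).vec) -
        F i *ᵥ ((F i)ᵀ *ᵥ (G.Cv X Y *ᵥ G.vecState X Y V i)) := by
  have hE' := hE i hi hiN
  have hF' := hF i hi hiN
  rw [mem_iff_transpose_mulVec_vec_eq_zero hE' hF', vec_coeffMat_youla, Matrix.mulVec_neg,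
    neg_eq_zero, Matrix.mulVec_add]
  constructor
  · intro h
    conv_lhs => rw [← mulVec_add_mulVec hE' hF' (coeffMat i V).vec]
    rw [eq_neg_of_add_eq_zero_right h, Matrix.mulVec_neg, sub_eq_add_neg]
  · intro h
    have h2 := congrArg ((F i)ᵀ *ᵥ ·) h
    simp only [Matrix.mulVec_sub] at h2
    rw [Matrix.mulVec_mulVec, transpose_mul_eq_zero hE' hF', Matrix.zero_mulVec, zero_sub,
      Matrix.mulVec_mulVec _ (F i)ᵀ (F i), hF'.1, Matrix.one_mulVec] at h2
    rw [h2, add_neg_cancel]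

variable (G X Y E F) in
/-- The input `vec V = Eᵢ u - Fᵢ Fᵢᵀ C_v x` turns the vectorized state recursion into that of the
time-varying system. -/
lemma vecSystem_dynamics (i : ℕ) (x : VecState n p₂ q₂ → ℝ) (u : Fin (e i) → ℝ) :
    G.Av X Y *ᵥ x + G.Bv *ᵥ (E i *ᵥ u - F i *ᵥ ((F i)ᵀ *ᵥ (G.Cv X Y *ᵥ x))) =
      (G.vecSystem X Y E F).A i *ᵥ x + (G.vecSystem X Y E F).B i *ᵥ u := by
  change _ = (G.Av X Y - G.Bv * F i * (F i)ᵀ * G.Cv X Y) *ᵥ x + (G.Bv * E i) *ᵥ u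
  simp only [Matrix.mulVec_sub, Matrix.sub_mulVec, Matrix.mulVec_mulVec, Matrix.mul_assoc]
  abel

variable (G X Y E F) in
lemma vecSystem_output (i : ℕ) (x : VecState n p₂ q₂ → ℝ) (u : Fin (e i) → ℝ) :
    sqrtMat (G.vecR X Y) *ᵥ (E i *ᵥ u - F i *ᵥ ((F i)ᵀ *ᵥ (G.Cv X Y *ᵥ x))) =
      (G.vecSystem X Y E F).C i *ᵥ x + (G.vecSystem X Y E F).D i *ᵥ u := by
  change _ = (-(sqrtMat (G.vecR X Y) * F i * (F i)ᵀ * G.Cv X Y)) *ᵥ x +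
    (sqrtMat (G.vecR X Y) * E i) *ᵥ u
  simp only [Matrix.mulVec_sub, Matrix.neg_mulVec, Matrix.mulVec_mulVec, Matrix.mul_assoc]
  abel

/-- The cost of a feasible point as the optimal value plus a sum of nonnegative deviations. -/
theorem qpCost_eq_add_deviation (hG : G.Standing) (hX : G.IsControlRiccati X)
    (hY : G.IsFilterRiccati Y)
    (hE : ∀ i, 1 ≤ i → i ≤ N → IsOrthonormalBasisOf (E i) (vecSet (𝒴 i)))
    (hF : ∀ i, 1 ≤ i → i ≤ N → IsOrthonormalBasisOf (F i) (vecPerpSet (𝒴 i)))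
    {V : TF p₂ q₂} (hV : V ∈ G.qpFeasible X Y N 𝒴) :
    G.qpCost X Y V = ENNReal.ofReal
      (G.vecInit Y ⬝ᵥ ((G.vecSystem X Y E F).riccati N 1 *ᵥ G.vecInit Y) +
        ∑ i ∈ Finset.Icc 1 N, (G.vecSystem X Y E F).deviation N i (G.vecState X Y V i)
          ((E i)ᵀ *ᵥ (coeffMat i V).vec)) := by
  rw [mem_qpFeasible_iff] at hV
  have hV' : ∀ i, 1 ≤ i → i ≤ N → _ := fun i hi hiN =>
    (mem_pattern_iff hE hF V hi hiN).1 (hV.2 i hi hiN)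
  have h := TVSystem.sum_cost_eq (T := G.vecSystem X Y E F) (N := N)
    (x := G.vecState X Y V) (u := fun i => (E i)ᵀ *ᵥ (coeffMat i V).vec)
    (posDef_vecSystem_D hG hX hY hE) fun i hi hiN => by
      rw [vecState_succ V hi, ← vecSystem_dynamics, ← hV' i hi hiN]
  rw [vecState_one (hV.1 0 (by omega))] at h
  rw [qpCost_eq_sum hG hX hY hV.1, ← h]
  congr 1
  refine Finset.sum_congr rfl fun i hi => ?_
  rw [Finset.mem_Icc] at hi
  rw [← vecSystem_output, ← hV' i hi.1 hi.2]

lemma vecState_eq_trajectory {V : TF p₂ q₂} (hV0 : coeffMat 0 V = 0)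
    (hV : ∀ i, 1 ≤ i → i ≤ N → (coeffMat i V).vec =
      (E i * (G.vecSystem X Y E F).gain N i - F i * (F i)ᵀ * G.Cv X Y) *ᵥ G.vecState X Y V i)
    {i : ℕ} (hi : 1 ≤ i) (hiN : i ≤ N + 1) :
    G.vecState X Y V i = (G.vecSystem X Y E F).trajectory N (G.vecInit Y) i := by
  induction i, hi using Nat.le_induction with
  | base => rw [vecState_one hV0]; rfl
  | succ i hi ih =>
    obtain ⟨j, rfl⟩ := Nat.exists_eq_add_of_le' hi
    rw [TVSystem.trajectory, ← ih (by omega), vecState_succ V hi, hV _ hi (by omega),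
      Matrix.add_mulVec, ← Matrix.mulVec_mulVec _ ((G.vecSystem X Y E F).B (j + 1)),
      ← vecSystem_dynamics]
    simp only [Matrix.sub_mulVec, Matrix.mulVec_mulVec, Matrix.mul_assoc]

/-- The two components of `vec Vᵢ` play separate roles: the `F`-part of the law is exactly the
pattern constraint, and the `E`-part is the choice of free input. -/
lemma vec_eq_feedback_iff
    (hE : ∀ i, 1 ≤ i → i ≤ N → IsOrthonormalBasisOf (E i) (vecSet (𝒴 i)))
    (hF : ∀ i, 1 ≤ i → i ≤ N → IsOrthonormalBasisOf (F i) (vecPerpSet (𝒴 i)))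
    {V : TF p₂ q₂} {i : ℕ} (hi : 1 ≤ i) (hiN : i ≤ N)
    (K : Matrix (Fin (e i)) (VecState n p₂ q₂) ℝ) :
    (coeffMat i V).vec = (E i * K - F i * (F i)ᵀ * G.Cv X Y) *ᵥ G.vecState X Y V i ↔
      coeffMat i (G.youla X Y V) ∈ 𝒴 i ∧
        (E i)ᵀ *ᵥ (coeffMat i V).vec = K *ᵥ G.vecState X Y V i := by
  have hE' := hE i hi hiN
  have hF' := hF i hi hiN
  have hEF : (E i)ᵀ * F i = 0 := by
    simpa using congrArg Matrix.transpose (transpose_mul_eq_zero hE' hF')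
  have h0 : (E i * K - F i * (F i)ᵀ * G.Cv X Y) *ᵥ G.vecState X Y V i =
      E i *ᵥ (K *ᵥ G.vecState X Y V i) -
        F i *ᵥ ((F i)ᵀ *ᵥ (G.Cv X Y *ᵥ G.vecState X Y V i)) := by
    simp only [Matrix.sub_mulVec, Matrix.mulVec_mulVec, Matrix.mul_assoc]
  rw [mem_pattern_iff hE hF V hi hiN, h0]
  constructor
  · intro h
    have h1 : (E i)ᵀ *ᵥ (coeffMat i V).vec = K *ᵥ G.vecState X Y V i := by
      rw [h, Matrix.mulVec_sub, Matrix.mulVec_mulVec, hE'.1, Matrix.one_mulVec,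
        Matrix.mulVec_mulVec _ (E i)ᵀ (F i), hEF, Matrix.zero_mulVec, sub_zero]
    exact ⟨by rw [h1]; exact h, h1⟩
  · rintro ⟨h, h1⟩
    rwa [h1] at h

variable (G X Y N E F) in
/-- The FIR matrix generated by the optimal feedback. -/
def optimalFIR : TF p₂ q₂ :=
  ofCoeffs fun i => if 1 ≤ i ∧ i ≤ N then
    -- The indices are swapped because `vec` stacks columns and lists the column index first.
    Matrix.of fun a b => ((E i * (G.vecSystem X Y E F).gain N i - F i * (F i)ᵀ * G.Cv X Y) *ᵥ
      (G.vecSystem X Y E F).trajectory N (G.vecInit Y) i) (b, a) else 0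

lemma optimalFIR_mem_strictFIR : G.optimalFIR X Y N E F ∈ strictFIR p₂ q₂ N := fun i hi => by
  rw [optimalFIR, coeffMat_ofCoeffs, if_neg hi]

lemma vec_coeffMat_optimalFIR {i : ℕ} (hi : 1 ≤ i) (hiN : i ≤ N) :
    (coeffMat i (G.optimalFIR X Y N E F)).vec =
      (E i * (G.vecSystem X Y E F).gain N i - F i * (F i)ᵀ * G.Cv X Y) *ᵥ
        (G.vecSystem X Y E F).trajectory N (G.vecInit Y) i := by
  rw [optimalFIR, coeffMat_ofCoeffs, if_pos ⟨hi, hiN⟩]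
  rfl

lemma vecState_optimalFIR {i : ℕ} (hi : 1 ≤ i) (hiN : i ≤ N + 1) :
    G.vecState X Y (G.optimalFIR X Y N E F) i =
      (G.vecSystem X Y E F).trajectory N (G.vecInit Y) i := by
  induction i, hi using Nat.le_induction with
  | base => rw [vecState_one (optimalFIR_mem_strictFIR 0 (by omega))]; rfl
  | succ i hi ih =>
    obtain ⟨j, rfl⟩ := Nat.exists_eq_add_of_le' hi
    rw [TVSystem.trajectory, vecState_succ _ hi, vec_coeffMat_optimalFIR hi (by omega),
      ih (by omega), Matrix.add_mulVec,
      ← Matrix.mulVec_mulVec _ ((G.vecSystem X Y E F).B (j + 1)), ← vecSystem_dynamics]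
    simp only [Matrix.sub_mulVec, Matrix.mulVec_mulVec, Matrix.mul_assoc]

/-- The feedback law is causal: followed along the state of `V` itself, it determines that state and
all coefficients recursively. -/
lemma eq_optimalFIR {V : TF p₂ q₂} (hV : V ∈ strictFIR p₂ q₂ N)
    (h : ∀ i, 1 ≤ i → i ≤ N → (coeffMat i V).vec =
      (E i * (G.vecSystem X Y E F).gain N i - F i * (F i)ᵀ * G.Cv X Y) *ᵥ G.vecState X Y V i) :
    V = G.optimalFIR X Y N E F := by
  refine TF.ext_coeffMat fun i => ?_
  by_cases hi : 1 ≤ i ∧ i ≤ N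
  · rw [← Matrix.vec_inj, vec_coeffMat_optimalFIR hi.1 hi.2, h i hi.1 hi.2,
      vecState_eq_trajectory (hV 0 (by omega)) h hi.1 (by omega)]
  · rw [hV i hi, optimalFIR_mem_strictFIR i hi]

lemma optimalFIR_feedback
    (hE : ∀ i, 1 ≤ i → i ≤ N → IsOrthonormalBasisOf (E i) (vecSet (𝒴 i)))
    (hF : ∀ i, 1 ≤ i → i ≤ N → IsOrthonormalBasisOf (F i) (vecPerpSet (𝒴 i)))
    {i : ℕ} (hi : 1 ≤ i) (hiN : i ≤ N) :
    coeffMat i (G.youla X Y (G.optimalFIR X Y N E F)) ∈ 𝒴 i ∧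
      (E i)ᵀ *ᵥ (coeffMat i (G.optimalFIR X Y N E F)).vec =
        (G.vecSystem X Y E F).gain N i *ᵥ G.vecState X Y (G.optimalFIR X Y N E F) i := by
  rw [← vec_eq_feedback_iff hE hF hi hiN, vecState_optimalFIR hi (by omega),
    vec_coeffMat_optimalFIR hi hiN]

lemma optimalFIR_mem_qpFeasible
    (hE : ∀ i, 1 ≤ i → i ≤ N → IsOrthonormalBasisOf (E i) (vecSet (𝒴 i)))
    (hF : ∀ i, 1 ≤ i → i ≤ N → IsOrthonormalBasisOf (F i) (vecPerpSet (𝒴 i))) :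
    G.optimalFIR X Y N E F ∈ G.qpFeasible X Y N 𝒴 :=
  mem_qpFeasible_iff.2 ⟨optimalFIR_mem_strictFIR,
    fun _ hi hiN => (optimalFIR_feedback hE hF hi hiN).1⟩

lemma optimalValue_nonneg (hG : G.Standing) (hX : G.IsControlRiccati X) (hY : G.IsFilterRiccati Y)
    (hE : ∀ i, 1 ≤ i → i ≤ N → IsOrthonormalBasisOf (E i) (vecSet (𝒴 i))) :
    0 ≤ G.vecInit Y ⬝ᵥ ((G.vecSystem X Y E F).riccati N 1 *ᵥ G.vecInit Y) := by
  have := (TVSystem.posSemidef_riccati (T := G.vecSystem X Y E F) (N := N)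
    (posDef_vecSystem_D hG hX hY hE) le_rfl).dotProduct_mulVec_nonneg (G.vecInit Y)
  rwa [star_trivial] at this

lemma qpCost_optimalFIR (hG : G.Standing) (hX : G.IsControlRiccati X) (hY : G.IsFilterRiccati Y)
    (hE : ∀ i, 1 ≤ i → i ≤ N → IsOrthonormalBasisOf (E i) (vecSet (𝒴 i)))
    (hF : ∀ i, 1 ≤ i → i ≤ N → IsOrthonormalBasisOf (F i) (vecPerpSet (𝒴 i))) :
    G.qpCost X Y (G.optimalFIR X Y N E F) =
    ENNReal.ofReal (G.vecInit Y ⬝ᵥ ((G.vecSystem X Y E F).riccati N 1 *ᵥ G.vecInit Y)) := by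
  rw [qpCost_eq_add_deviation hG hX hY hE hF (optimalFIR_mem_qpFeasible hE hF),
    Finset.sum_eq_zero, add_zero]
  intro i hi
  rw [Finset.mem_Icc] at hi
  rw [TVSystem.deviation, (optimalFIR_feedback hE hF hi.1 hi.2).2, sub_self, zero_dotProduct]

lemma qpCost_optimalFIR_lt (hG : G.Standing) (hX : G.IsControlRiccati X) (hY : G.IsFilterRiccati Y)
    (hE : ∀ i, 1 ≤ i → i ≤ N → IsOrthonormalBasisOf (E i) (vecSet (𝒴 i)))
    (hF : ∀ i, 1 ≤ i → i ≤ N → IsOrthonormalBasisOf (F i) (vecPerpSet (𝒴 i)))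
    {W : TF p₂ q₂} (hW : W ∈ G.qpFeasible X Y N 𝒴)
    (hne : W ≠ G.optimalFIR X Y N E F) :
    G.qpCost X Y (G.optimalFIR X Y N E F) < G.qpCost X Y W := by
  have hD := posDef_vecSystem_D (F := F) hG hX hY hE
  have hv := optimalValue_nonneg (F := F) hG hX hY hE
  rw [qpCost_optimalFIR hG hX hY hE hF, qpCost_eq_add_deviation hG hX hY hE hF hW]
  have hnn : ∀ i ∈ Finset.Icc 1 N, 0 ≤ (G.vecSystem X Y E F).deviation N i (G.vecState X Y W i)
      ((E i)ᵀ *ᵥ (coeffMat i W).vec) := fun i hi => by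
    rw [Finset.mem_Icc] at hi
    exact TVSystem.deviation_nonneg hD hi.1 hi.2 _ _
  have hpos : 0 < ∑ i ∈ Finset.Icc 1 N, (G.vecSystem X Y E F).deviation N i
      (G.vecState X Y W i) ((E i)ᵀ *ᵥ (coeffMat i W).vec) := by
    -- If every deviation vanished, positive definiteness of the weights would force `W` to follow
    -- the optimal feedback law, hence to be the optimal FIR matrix.
    refine (Finset.sum_nonneg hnn).lt_of_ne' fun h0 => hne ?_
    rw [Finset.sum_eq_zero_iff_of_nonneg hnn] at h0
    rw [mem_qpFeasible_iff] at hW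
    refine eq_optimalFIR hW.1 fun i hi hiN => ?_
    rw [vec_eq_feedback_iff hE hF hi hiN]
    exact ⟨hW.2 i hi hiN, TVSystem.eq_of_deviation_eq_zero hD hi hiN
      (h0 i (Finset.mem_Icc.2 ⟨hi, hiN⟩))⟩
  exact (ENNReal.ofReal_lt_ofReal_iff (by linarith)).2 (by linarith)

end Program

end Plant

end DelayHTwo

end

theorem theorem4 {n p₁ p₂ q₁ q₂ N : ℕ} (hN : 1 ≤ N)
    (G : DelayHTwo.Plant n p₁ p₂ q₁ q₂) (hG : G.Standing)
    (𝒴 : ℕ → Submodule ℝ (Matrix (Fin p₂) (Fin q₂) ℝ))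
    (hQI : DelayHTwo.QuadraticallyInvariant (DelayHTwo.delaySpace N 𝒴) G.G₂₂)
    (X Y : Matrix (Fin n) (Fin n) ℝ) (hX : G.IsControlRiccati X) (hY : G.IsFilterRiccati Y)
    {e f : ℕ → ℕ}
    (E : (i : ℕ) → Matrix (DelayHTwo.VecIdx p₂ q₂) (Fin (e i)) ℝ)
    (F : (i : ℕ) → Matrix (DelayHTwo.VecIdx p₂ q₂) (Fin (f i)) ℝ)
    (hE : ∀ i, 1 ≤ i → i ≤ N → DelayHTwo.IsOrthonormalBasisOf (E i) (DelayHTwo.vecSet (𝒴 i)))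
    (hF : ∀ i, 1 ≤ i → i ≤ N → DelayHTwo.IsOrthonormalBasisOf (F i) (DelayHTwo.vecPerpSet (𝒴 i)))
    (T : DelayHTwo.TVSystem (DelayHTwo.Plant.VecState n p₂ q₂) (DelayHTwo.VecIdx p₂ q₂) e)
    (hT : T = G.vecSystem X Y E F)
    (x₁ : DelayHTwo.Plant.VecState n p₂ q₂ → ℝ) (hx₁ : x₁ = G.vecInit Y)
    (x : ℕ → DelayHTwo.Plant.VecState n p₂ q₂ → ℝ) (hx : x = T.trajectory N x₁)
    (v : ℝ) (hv : v = dotProduct x₁ ((T.riccati N 1).mulVec x₁)) :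
    ∃ V : DelayHTwo.TF p₂ q₂,
      -- the FIR matrix generated by the recursion
      V ∈ DelayHTwo.strictFIR p₂ q₂ N ∧
      (∀ i, 1 ≤ i → i ≤ N → (DelayHTwo.coeffMat i V).vec =
        (E i * T.gain N i - F i * (F i).transpose * G.Cv X Y).mulVec (x i)) ∧
      -- it is the unique optimal solution of the quadratic program, with value `v`
      V ∈ G.qpFeasible X Y N 𝒴 ∧
      (∀ W ∈ G.qpFeasible X Y N 𝒴, W ≠ V → G.qpCost X Y V < G.qpCost X Y W) ∧
      0 ≤ v ∧ G.qpCost X Y V = ENNReal.ofReal v ∧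
      -- the corresponding controller is admissible, stabilizing, and optimal
      G.controller X Y V ∈ DelayHTwo.delaySpace N 𝒴 ∧
      G.InternallyStabilizes (G.controller X Y V) ∧
      DelayHTwo.h2NormSq (G.closedLoop (G.controller X Y V)) =
        DelayHTwo.h2NormSq (G.P₁₁ X Y) + ENNReal.ofReal v ∧
      -- optimal value of the decentralized problem
      DelayHTwo.h2NormSq (G.P₁₁ X Y) ≠ ⊤ ∧
      IsLeast {c : ENNReal | ∃ K ∈ DelayHTwo.delaySpace N 𝒴,
          c = DelayHTwo.h2NormSq (G.closedLoop K)}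
        (DelayHTwo.h2NormSq (G.P₁₁ X Y) + ENNReal.ofReal v) := by
  subst hT hx₁ hx hv
  have hle : ∀ W ∈ G.qpFeasible X Y N 𝒴,
      G.qpCost X Y (G.optimalFIR X Y N E F) ≤ G.qpCost X Y W := by
    intro W hW
    by_cases h : W = G.optimalFIR X Y N E F
    · rw [h]
    · exact (DelayHTwo.Plant.qpCost_optimalFIR_lt hG hX hY hE hF hW h).le
  have hfeas := DelayHTwo.Plant.optimalFIR_mem_qpFeasible (G := G) (X := X) (Y := Y) hE hF
  have hcost := DelayHTwo.Plant.qpCost_optimalFIR hG hX hY hE hF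
  have hmem := DelayHTwo.Plant.controller_mem_delaySpace hQI hfeas
  have hclosed := DelayHTwo.Plant.h2NormSq_closedLoop_controller hG hX hY hfeas.1
  rw [hcost] at hclosed
  refine ⟨G.optimalFIR X Y N E F, hfeas.1,
    fun i hi hiN => DelayHTwo.Plant.vec_coeffMat_optimalFIR hi hiN, hfeas,
    fun W hW hne => DelayHTwo.Plant.qpCost_optimalFIR_lt hG hX hY hE hF hW hne,
    DelayHTwo.Plant.optimalValue_nonneg hG hX hY hE, hcost, hmem,
    DelayHTwo.Plant.internallyStabilizes_controller hX hY
      (DelayHTwo.Plant.entriesIn_of_mem_strictFIR _ hfeas.1), hclosed,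
    DelayHTwo.isH2_iff_h2NormSq_ne_top.1 (DelayHTwo.Plant.isH2_P₁₁ hX hY),
    ⟨_, hmem, hclosed.symm⟩, ?_⟩
  rintro _ ⟨K, hK, rfl⟩
  -- The set ranges over all controllers in the delay space, including those of infinite cost, for
  -- which the Youla parameter need not lie in `H₂`.
  by_cases hfin : DelayHTwo.h2NormSq (G.closedLoop K) = ⊤
  · rw [hfin]; exact le_top
  · obtain ⟨W, hW, hWle⟩ := DelayHTwo.Plant.exists_qpFeasible_le hG hX hY hQI hK hfin
    refine le_trans ?_ hWle
    rw [← hcost]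
    gcongr
    exact hle W hW
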